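/- Let $(\Omega,d_c)$ be an edit space: $\Omega$ is a set of objects with a null element $0_\Omega$ and an equivalence relation $\sim$; edit operations transform objects of $\Omega$ into other objects and have nonnegative (rational) costs $c$; an edit path is a finite sequence of operations and its cost is the sum of their costs; $\mathcal P(x,y)$ is the set of edit paths that transform $x$ into some $z\sim y$; $d_c(x,y)=\min_{P\in\mathcal P(x,y)}c(P)$ is a well-defined pseudometric (a metric if $\sim$ is equality); and every object can be constructed from $0_\Omega$ by insertion operations only. Fix encodings of the objects and of the operations. Given a finite dataset $X=\{x_1,\dots,x_n\}\subset\Omega$, put $x_0:=0_\Omega$. An edit arborescence on $X\cup\{0_\Omega\}$ is a pair $(\mathcal A,\Psi)$, where $\mathcal A$ assigns to each $i\in\{1,\dots,n\}$ a parent index $\mathcal A[i]\in\{0,\dots,n\}$ so that an arborescence rooted at $0$ results, and $\Psi=(P_1,\dots,P_n)$ with $P_i\in\mathcal P(x_{\mathcal A[i]},x_i)$; its cost is $\sum_{i=1}^n c(P_i)$. The Minimum Edit Arborescence Problem (MEA) asks, given $X$, for an edit arborescence of minimum cost. 1. Suppose that there is a polynomial-time algorithm that, given $x,y\in\Omega$,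 computes a minimum-cost edit path from $x$ to $y$ together with its cost $d_c(x,y)$. Then MEA can be solved in polynomial time, and its decision version (given $X$ and a rational $k\ge 0$, is there an edit arborescence of cost at most $k$?) belongs to the class P. 2. Let $D$ be any algorithm that, given $x,y\in\Omega$, computes a minimum-cost edit path from $x$ to $y$ together with its cost. Then there is an algorithm for MEA which, on each dataset with $n$ objects, makes $O(n^2)$ calls of $D$ and takes $O(n^2\,T+(n+1)^2)$ steps in total, where $T$ is any bound on the cost of a call of $D$ on two of the objects $x_0,\dots,x_n$ (its running time plus the time for passing its input and output). Here the model is a random access machine on which addition, subtraction and comparison of numbers take one step; the implied constants may depend on the edit space, the encodings and $D$, but not on the dataset or on $T$. -/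

import Mathlib

/-! ## Edit spaces -/

/-- The data of an edit space: objects `Ω`, edit operations `Op`. An operation transforms an object
into another one, when it is applicable to it. -/
structure EditSystem (Ω : Type*) (Op : Type*) where
  /-- Result of an operation on an object; `none` if the operation is not applicable. -/
  applyOp : Op → Ω → Option Ω
  /-- Cost of an edit operation. The costs are rational because a machine computes with them. -/
  cost : Op → ℚ≥0
  /-- The equivalence relation up to which targets are reached. -/
  equiv : Setoid Ω
  /-- The null element. -/
  null : Ω
  /-- Which operations are insertions. -/
  insertions : Set Op

namespace EditSystem

variable {Ω : Type*} {Op : Type*} (E : EditSystem Ω Op)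

/-- Apply a sequence of operations, from left to right. -/
def applyPath : List Op → Ω → Option Ω
  | [], x => some x
  | o :: P, x => (E.applyOp o x).bind (applyPath P)

/-- The set of all edit paths that transform `x` into an element of the class of `y`. -/
def editPaths (x y : Ω) : Set (List Op) :=
  {P | ∃ z, E.applyPath P x = some z ∧ E.equiv.r y z}

/-- The cost of an edit path is the sum of the costs of its operations. -/
def pathCost (P : List Op) : ℚ≥0 := (P.map E.cost).sum

/-- `P` is a minimum-cost edit path from `x` to `y`. -/
def IsMinEditPath (x y : Ω) (P : List Op) : Prop :=
  P ∈ E.editPaths x y ∧ ∀ Q ∈ E.editPaths x y, E.pathCost P ≤ E.pathCost Q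

/-- The edit distance (the infimum is a minimum in an edit space, by `exists_min` below). -/
noncomputable def editDist (x y : Ω) : ℝ :=
  ⨅ P : E.editPaths x y, ((E.pathCost P.1 : ℚ≥0) : ℝ)

/-- The standing assumptions on an edit space: the distance is well defined, it is a pseudometric,
and a metric if the equivalence relation is equality; every object can be constructed from the null
element by insertions only. -/
structure IsEditSpace : Prop where
  exists_min : ∀ x y, ∃ P, E.IsMinEditPath x y P
  dist_comm : ∀ x y, E.editDist x y = E.editDist y x
  dist_triangle : ∀ x y z, E.editDist x z ≤ E.editDist x y + E.editDist y z
  eq_of_dist_eq_zero : (∀ x y, E.equiv.r x y → x = y) → ∀ x y, E.editDist x y = 0 → x = y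
  constructible : ∀ x, ∃ P ∈ E.editPaths E.null x, ∀ o ∈ P, o ∈ E.insertions

/-! ## Edit arborescences -/

/-- The nodes `x₀ = 0, x₁, …, xₙ` given by an enumeration `xs = [x₁, …, xₙ]` of the dataset. -/
def node (xs : List Ω) : Fin (xs.length + 1) → Ω := Fin.cons E.null xs.get

/-- An edit arborescence on `x₀ = 0, x₁, …, xₙ`, rooted at index `0`. Entry `i` of the sequences
`parent` and `path` belongs to the node with index `i + 1 = i.succ`. A node other than the root has
exactly one parent and the root has none, so there is exactly one directed path from the root to
every node as soon as there is one. -/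
structure EditArborescence (xs : List Ω) where
  parent : Fin xs.length → Fin (xs.length + 1)
  reachable : ∀ v, Relation.ReflTransGen (fun a b => ∃ i, a = parent i ∧ b = Fin.succ i) 0 v
  path : Fin xs.length → List Op
  path_mem : ∀ i, path i ∈ E.editPaths (E.node xs (parent i)) (E.node xs i.succ)

variable {E}

/-- The cost of an edit arborescence: the sum of the costs of its edit paths. -/
def EditArborescence.cost {xs : List Ω} (T : E.EditArborescence xs) : ℚ≥0 :=
  ∑ i, E.pathCost (T.path i)

/-- `T` has minimum cost among all edit arborescences on the same nodes. -/
def EditArborescence.IsMinimum {xs : List Ω} (T : E.EditArborescence xs) : Prop :=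
  ∀ T' : E.EditArborescence xs, T.cost ≤ T'.cost

end EditSystem

/-! ## Random access machines

A word is a rational number. A machine has registers, finitely many memories (those named in the
program) with random access, and a write-only output. It adds, subtracts and compares words, and
every instruction takes one step, except that calling a subroutine costs the running time of the
subroutine and the number of words passed to and from it. There is no multiplication, so that after
`t` steps every word is an integer combination, with coefficients at most `2 ^ t` in absolute value,
of input words, constants of the program, and lengths of word sequences. The bit lengths of all words are therefore bounded by a polynomial in `t`
and the bit length of the input, and polynomial time on these machines is the same as polynomial
time on Turing machines. -/
namespace RAM

/-- Programs. Registers and memories are named by natural numbers. -/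
inductive Prog : Type
  /-- do nothing -/
  | skip : Prog
  /-- `const r q`: register `r` becomes `q` -/
  | const (r : ℕ) (q : ℚ) : Prog
  /-- `add r a b`: register `r` becomes the sum of registers `a` and `b` -/
  | add (r a b : ℕ) : Prog
  /-- `sub r a b`: register `r` becomes the difference of registers `a` and `b` -/
  | sub (r a b : ℕ) : Prog
  /-- `load r m a`: register `r` becomes the word of memory `m` at the address in register `a` -/
  | load (r m a : ℕ) : Prog
  /-- `store m a r`: memory `m` at the address in register `a` becomes the word in register `r` -/
  | store (m a r : ℕ) : Prog
  /-- append the word in register `r` to the output -/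
  | write (r : ℕ) : Prog
  /-- sequential composition -/
  | seq (p q : Prog) : Prog
  /-- `ite a b p q`: run `p` if register `a` is at most register `b`, and `q` otherwise -/
  | ite (a b : ℕ) (p q : Prog) : Prog
  /-- `while a b p`: repeat `p` as long as register `a` is less than register `b` -/
  | while (a b : ℕ) (p : Prog) : Prog
  /-- `call p m l d r`: run the subroutine `p` in a fresh environment on the first words of memory
  `m`, as many as register `l` says; its output becomes the first words of memory `d`, and its
  number of words is put into register `r` -/
  | call (p : Prog) (m l d r : ℕ) : Prog
  deriving DecidableEq

/-- Configurations. -/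
structure State where
  reg : ℕ → ℚ
  mem : ℕ → ℕ → ℚ
  out : List ℚ

/-- The initial configuration on input `w`: the input is in memory `0`, its number of words in
register `0`; all else is zero and nothing has been written. -/
def State.init (w : List ℚ) : State where
  reg := fun r => if r = 0 then (w.length : ℚ) else 0
  mem := fun m i => if m = 0 then w.getD i 0 else 0
  out := []

/-- Change one register. -/
def State.setReg (s : State) (r : ℕ) (q : ℚ) : State :=
  { s with reg := fun r' => if r' = r then q else s.reg r' }

/-- Change one word of one memory. -/
def State.setMem (s : State) (m i : ℕ) (q : ℚ) : State :=
  { s with mem := fun m' i' => if m' = m ∧ i' = i then q else s.mem m' i' }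

/-- The address, or number, that register `a` holds. -/
def State.addr (s : State) (a : ℕ) : ℕ := ⌊s.reg a⌋₊

/-- The first `l` words of memory `m`. -/
def State.slice (s : State) (m l : ℕ) : List ℚ := (List.range l).map (s.mem m)

/-- Put the words `w` at the beginning of memory `m`. -/
def State.paste (s : State) (m : ℕ) (w : List ℚ) : State :=
  { s with mem := fun m' i => if m' = m then w.getD i (s.mem m i) else s.mem m' i }

/-- The cost of a call: the instruction, passing the argument words `w`, the running time `t` of
the subroutine, and passing back its output words `v`. -/
def callCost (w v : List ℚ) (t : ℕ) : ℕ := 1 + w.length + t + v.length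

/-- `Exec p s s' t c`: started in `s`, the program `p` halts in `s'` after `t` steps, and `c` lists
the subroutines that were called on the way, once for each call (also calls within calls). -/
inductive Exec : Prog → State → State → ℕ → List Prog → Prop
  | skip (s : State) : Exec .skip s s 1 []
  | const (s : State) (r : ℕ) (q : ℚ) : Exec (.const r q) s (s.setReg r q) 1 []
  | add (s : State) (r a b : ℕ) :
      Exec (.add r a b) s (s.setReg r (s.reg a + s.reg b)) 1 []
  | sub (s : State) (r a b : ℕ) :
      Exec (.sub r a b) s (s.setReg r (s.reg a - s.reg b)) 1 []
  | load (s : State) (r m a : ℕ) :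
      Exec (.load r m a) s (s.setReg r (s.mem m (s.addr a))) 1 []
  | store (s : State) (m a r : ℕ) :
      Exec (.store m a r) s (s.setMem m (s.addr a) (s.reg r)) 1 []
  | write (s : State) (r : ℕ) :
      Exec (.write r) s { s with out := s.out ++ [s.reg r] } 1 []
  | seq {p q : Prog} {s s₁ s₂ : State} {t₁ t₂ : ℕ} {c₁ c₂ : List Prog} :
      Exec p s s₁ t₁ c₁ → Exec q s₁ s₂ t₂ c₂ → Exec (.seq p q) s s₂ (t₁ + t₂) (c₁ ++ c₂)
  | ite_true {a b : ℕ} {p q : Prog} {s s' : State} {t : ℕ} {c : List Prog} :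
      s.reg a ≤ s.reg b → Exec p s s' t c → Exec (.ite a b p q) s s' (1 + t) c
  | ite_false {a b : ℕ} {p q : Prog} {s s' : State} {t : ℕ} {c : List Prog} :
      ¬ s.reg a ≤ s.reg b → Exec q s s' t c → Exec (.ite a b p q) s s' (1 + t) c
  | while_false {a b : ℕ} {p : Prog} {s : State} :
      ¬ s.reg a < s.reg b → Exec (.while a b p) s s 1 []
  | while_true {a b : ℕ} {p : Prog} {s s₁ s₂ : State} {t₁ t₂ : ℕ} {c₁ c₂ : List Prog} :
      s.reg a < s.reg b → Exec p s s₁ t₁ c₁ → Exec (.while a b p) s₁ s₂ t₂ c₂ →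
        Exec (.while a b p) s s₂ (1 + t₁ + t₂) (c₁ ++ c₂)
  | call {p : Prog} {m l d r : ℕ} {s s₁ : State} {t : ℕ} {c : List Prog} :
      Exec p (State.init (s.slice m (s.addr l))) s₁ t c →
        Exec (.call p m l d r) s ((s.paste d s₁.out).setReg r (s₁.out.length : ℚ))
          (callCost (s.slice m (s.addr l)) s₁.out t) (p :: c)

/-- On input `w` the program `p` halts with output `v` after `t` steps; `c` lists the calls. -/
def Runs (p : Prog) (w v : List ℚ) (t : ℕ) (c : List Prog) : Prop :=
  ∃ s, Exec p (State.init w) s t c ∧ s.out = v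

end RAM

/-! ## Problems and polynomial time -/

/-- The number of bits of a sequence of words. -/
def bitSize (w : List ℚ) : ℕ := (w.map fun q => 1 + q.num.natAbs.size + q.den.size).sum

/-- A computational problem: instances, their encoding, and the correct outputs. -/
structure Problem where
  Instance : Type*
  encode : Instance → List ℚ
  Correct : Instance → List ℚ → Prop

/-- The program `p` solves the problem. -/
def Problem.SolvedBy (Q : Problem) (p : RAM.Prog) : Prop :=
  ∀ a, ∃ v t c, RAM.Runs p (Q.encode a) v t c ∧ Q.Correct a v

/-- The problem is solved by a program whose running time is bounded by a polynomial in the bit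
length of the instance. -/
def Problem.PolyTime (Q : Problem) : Prop :=
  ∃ (p : RAM.Prog) (f : Polynomial ℕ), ∀ a, ∃ v t c,
    RAM.Runs p (Q.encode a) v t c ∧ Q.Correct a v ∧ t ≤ f.eval (bitSize (Q.encode a))

open Classical in
/-- The problem to decide a predicate; the answers are `1` (yes) and `0` (no). -/
noncomputable def decisionProblem {α : Type*} (enc : α → List ℚ) (A : α → Prop) : Problem where
  Instance := α
  encode := enc
  Correct := fun a v => v = if A a then [1] else [0]

/-- The predicate `A`, on instances encoded by `enc`, belongs to the class P. -/
def InP {α : Type*} (enc : α → List ℚ) (A : α → Prop) : Prop :=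
  (decisionProblem enc A).PolyTime

/-- An encoding of the elements of a type by sequences of words. -/
structure WordEncoding (α : Type*) where
  enc : α → List ℚ
  injective : Function.Injective enc

/-- A sequence of words, preceded by its length. -/
def withLength (w : List ℚ) : List ℚ := (w.length : ℚ) :: w

namespace WordEncoding

variable {α : Type*} (e : WordEncoding α)

/-- Encoding of pairs. -/
def encPair (a : α × α) : List ℚ := withLength (e.enc a.1) ++ withLength (e.enc a.2)

/-- Encoding of lists: the number of entries, and then the entries, each with its length. -/
def encList (l : List α) : List ℚ := (l.length : ℚ) :: l.flatMap fun a => withLength (e.enc a)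

end WordEncoding

namespace EditSystem

variable {Ω : Type*} {Op : Type*} (E : EditSystem Ω Op)
  (eΩ : WordEncoding Ω) (eOp : WordEncoding Op)

/-- Computation of minimum-cost edit paths: given `x` and `y`, find a minimum-cost edit path `P`
from `x` to `y`. The output is the cost of `P`, that is, the edit distance, followed by `P`. -/
def minEditPathProblem : Problem where
  Instance := Ω × Ω
  encode := eΩ.encPair
  Correct := fun a v =>
    ∃ P, E.IsMinEditPath a.1 a.2 P ∧ v = ((E.pathCost P : ℚ≥0) : ℚ) :: eOp.encList P

variable {E} in
/-- Encoding of an edit arborescence: the number `n`, and then, for each of the nodes `1, …, n`,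
the index of its parent and its edit path. -/
def EditArborescence.encode {xs : List Ω} (T : E.EditArborescence xs) : List ℚ :=
  (xs.length : ℚ) ::
    (List.ofFn fun i => (((T.parent i : ℕ) : ℚ) :: eOp.encList (T.path i))).flatten

/-- The minimum edit arborescence problem: given (an enumeration of) a finite dataset, find a
minimum-cost edit arborescence on the dataset together with the null element, rooted at the null
element. -/
def meaProblem : Problem where
  Instance := List Ω
  encode := eΩ.encList
  Correct := fun xs v => ∃ T : E.EditArborescence xs, T.IsMinimum ∧ v = T.encode eOp

/-- The decision version of the problem: is there an edit arborescence of cost at most `k`? -/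
def MEADecision (a : ℚ≥0 × List Ω) : Prop := ∃ T : E.EditArborescence a.2, T.cost ≤ a.1

end EditSystem

/-- The encoding of the instances of the decision version: the threshold, then the dataset. -/
def WordEncoding.encMEADecision {Ω : Type*} (eΩ : WordEncoding Ω) (a : ℚ≥0 × List Ω) : List ℚ :=
  ((a.1 : ℚ≥0) : ℚ) :: eΩ.encList a.2

/-! An edit path along the arc from `u` to `v` costs at least the edit distance of the two objects,
and minimum-cost paths attain it. So an optimal edit arborescence is a spanning arborescence of
minimum weight in the complete digraph on the n + 1 nodes, weighted by edit distances, with each arc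
filled by a minimum-cost path. The distance is symmetric, so orientation does not affect weight, and
Prim's algorithm, grown from the root, finds the optimum.

Correctness is an exchange argument that avoids any theory of trees. The invariant `IsOptimalPart`
compares the tree grown on `S` with every arborescence `g` at once: some edges of `g` still connect
all nodes to `S`, and together with the tree they weigh at most as much as `g`. When a node joins
`S`, one of these edges that crosses the cut becomes superfluous (`Connects.exchange`), and it is at
least as heavy as the lightest cut edge (`IsOptimalPart.extend`). When `S` is everything,
nonnegativity of the weights finishes the comparison (`IsOptimalPart.le`).

The algorithm is an explicit program, verified with a calculus `wp` that tracks final state, steps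
and calls together. A round asks `D` for the distances from the newest node only, and each outside
node remembers its nearest tree node, so n rounds make at most n² queries (`wp_grow`, `wp_prim`).
Edit paths are not stored: n further queries produce them again while the result is written
(`wp_writeTree`). The root is not part of the input, so its encoding is built into the program and
its length enters the constant.

For polynomial time, `T` is a polynomial in the bit size of the input: every argument of `D` is made
of pieces of the input and the fixed root, and an output is no longer than the running time. -/

/-! ## Minimum spanning arborescences -/

section Spanning

variable {V ι : Type*} (p q : ι → V)

/-- Two vertices are linked by one of the edges with index in `I`, in either direction. -/
def LinkedBy (I : Set ι) (a b : V) : Prop := ∃ i ∈ I, (a = p i ∧ b = q i) ∨ (a = q i ∧ b = p i)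

/-- Every vertex is connected to `S` by edges with index in `I`. -/
def Connects (I : Set ι) (S : Set V) : Prop :=
  ∀ v, ∃ s ∈ S, Relation.ReflTransGen (LinkedBy p q I) v s

variable {p q}

theorem LinkedBy.symm {I : Set ι} {a b : V} (h : LinkedBy p q I a b) : LinkedBy p q I b a := by
  obtain ⟨i, hi, h | h⟩ := h
  · exact ⟨i, hi, .inr h.symm⟩
  · exact ⟨i, hi, .inl h.symm⟩

theorem reflTransGen_linkedBy_symm {I : Set ι} {a b : V}
    (h : Relation.ReflTransGen (LinkedBy p q I) a b) : Relation.ReflTransGen (LinkedBy p q I) b a := by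
  induction h with
  | refl => exact .refl
  | tail _ hbc ih => exact .head hbc.symm ih

/-- A path from outside `S` into `S` has a first edge that crosses the cut. -/
theorem exists_crossing_edge {I : Set ι} {S : Set V} {v s : V} (hs : s ∈ S)
    (h : Relation.ReflTransGen (LinkedBy p q I) v s) (hv : v ∉ S) :
    ∃ i ∈ I, ∃ a b, ((a = p i ∧ b = q i) ∨ (a = q i ∧ b = p i)) ∧ a ∈ S ∧ b ∉ S ∧
      Relation.ReflTransGen (LinkedBy p q (I \ {i})) v b := by
  -- Strengthened claim: the part of the path before the crossing stays outside `S`. It cannot use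
  -- `i`, which has an endpoint in `S`.
  suffices H : ∃ i ∈ I, ∃ a b, ((a = p i ∧ b = q i) ∨ (a = q i ∧ b = p i)) ∧ a ∈ S ∧ b ∉ S ∧
      Relation.ReflTransGen (fun x y => LinkedBy p q I x y ∧ x ∉ S ∧ y ∉ S) v b by
    obtain ⟨i, hi, a, b, hab, ha, hb, hvb⟩ := H
    refine ⟨i, hi, a, b, hab, ha, hb, Relation.ReflTransGen.mono ?_ _ _ hvb⟩
    rintro x y ⟨⟨j, hj, hxy⟩, hx, hy⟩
    refine ⟨j, ⟨hj, ?_⟩, hxy⟩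
    rintro rfl
    grind
  induction h using Relation.ReflTransGen.head_induction_on with
  | refl => exact absurd hs hv
  | head h _ ih =>
    rename_i x y _
    by_cases hy : y ∈ S
    · obtain ⟨i, hi, hxy⟩ := h
      exact ⟨i, hi, y, x, by tauto, hy, hv, .refl⟩
    · obtain ⟨i, hi, a, b, hab, ha, hb, hyb⟩ := ih hy
      exact ⟨i, hi, a, b, hab, ha, hb, .head ⟨h, hv, hy⟩ hyb⟩

/-- Exchange: when a vertex is added to `S`, an edge that crosses the cut can be dropped. -/
theorem Connects.exchange {I : Set ι} {S : Set V} (h : Connects p q I S) {v : V} (hv : v ∉ S) :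
    ∃ i ∈ I, ((p i ∈ S ∧ q i ∉ S) ∨ (q i ∈ S ∧ p i ∉ S)) ∧
      Connects p q (I \ {i}) (insert v S) := by
  obtain ⟨s, hs, hvs⟩ := h v
  obtain ⟨i, hi, a, b, hab, ha, hb, hvb⟩ := exists_crossing_edge hs hvs hv
  refine ⟨i, hi, by grind, fun x => ?_⟩
  obtain ⟨s', hs', hx⟩ := h x
  induction hx using Relation.ReflTransGen.head_induction_on with
  | refl => exact ⟨s', .inr hs', .refl⟩
  | head h _ ih =>
    rename_i x y _
    obtain ⟨j, hj, hxy⟩ := h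
    -- Only a use of the dropped edge needs a detour. Its endpoint `a` lies in `S`, and its endpoint
    -- `b` is still joined to `v`, which now counts as a target.
    by_cases hji : j = i
    · subst hji
      have : x = a ∨ x = b := by grind
      rcases this with rfl | rfl
      · exact ⟨x, .inr ha, .refl⟩
      · exact ⟨v, .inl rfl, reflTransGen_linkedBy_symm hvb⟩
    · obtain ⟨s₁, hs₁, hy⟩ := ih
      exact ⟨s₁, hs₁, .head ⟨j, ⟨hj, hji⟩, hxy⟩ hy⟩

end Spanning

/-! ### Growing a tree along lightest cut edges -/

section Growing

variable {n : ℕ} (w : Fin (n + 1) → Fin (n + 1) → ℚ)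

/-- A parent function of the nodes `1, …, n` that defines an arborescence with root `0`. -/
def IsArborescence (f : Fin n → Fin (n + 1)) : Prop :=
  ∀ v, Relation.ReflTransGen (fun a b => ∃ i, a = f i ∧ b = Fin.succ i) 0 v

/-- Within `S`, the parent function `f` defines an arborescence with root `0` and total weight `c`,
and this part can be completed with no more weight than any arborescence has. -/
structure IsOptimalPart (S : Finset (Fin (n + 1))) (f : Fin (n + 1) → Fin (n + 1)) (c : ℚ) :
    Prop where
  zero_mem : 0 ∈ S
  reach : ∀ v ∈ S, Relation.ReflTransGen (fun a b => b ∈ S ∧ b ≠ 0 ∧ a = f b) 0 v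
  cost : c = ∑ v ∈ S.erase 0, w (f v) v
  optimal : ∀ g : Fin n → Fin (n + 1), IsArborescence g → ∃ I : Finset (Fin n),
    Connects g Fin.succ (I : Set (Fin n)) (S : Set (Fin (n + 1))) ∧
      c + ∑ i ∈ I, w (g i) i.succ ≤ ∑ i, w (g i) i.succ

variable {w}

theorem isOptimalPart_singleton (f : Fin (n + 1) → Fin (n + 1)) : IsOptimalPart w {0} f 0 where
  zero_mem := by simp
  reach := by simp [Relation.ReflTransGen.refl]
  cost := by simp
  optimal := fun g hg => by
    refine ⟨Finset.univ, fun v => ⟨0, by simp,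
      reflTransGen_linkedBy_symm (Relation.ReflTransGen.mono ?_ _ _ (hg v))⟩, by simp⟩
    rintro a b ⟨i, ha, hb⟩
    exact ⟨i, by simp, .inl ⟨ha, hb⟩⟩

/-- Lets the parent of a new node be fixed before the node joins `S`. -/
theorem IsOptimalPart.congr {S : Finset (Fin (n + 1))} {f f' : Fin (n + 1) → Fin (n + 1)} {c : ℚ}
    (h : IsOptimalPart w S f c) (hf : ∀ v ∈ S, v ≠ 0 → f v = f' v) : IsOptimalPart w S f' c where
  zero_mem := h.zero_mem
  reach := fun v hv => Relation.ReflTransGen.mono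
    (fun a b ⟨h1, h2, h3⟩ => ⟨h1, h2, by rw [h3, hf b h1 h2]⟩) _ _ (h.reach v hv)
  cost := by
    rw [h.cost]
    refine Finset.sum_congr rfl fun v hv => ?_
    rw [hf v (Finset.mem_of_mem_erase hv) (Finset.ne_of_mem_erase hv)]
  optimal := h.optimal

/-- An optimal part is extended by a lightest edge that leaves it. -/
theorem IsOptimalPart.extend (hw : ∀ a b, w a b = w b a) {S : Finset (Fin (n + 1))}
    {f : Fin (n + 1) → Fin (n + 1)} {c : ℚ} (h : IsOptimalPart w S f c) {v : Fin (n + 1)}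
    (hv : v ∉ S) (hf : f v ∈ S) (hmin : ∀ a ∈ S, ∀ b ∉ S, w (f v) v ≤ w a b) :
    IsOptimalPart w (insert v S) f (c + w (f v) v) where
  zero_mem := Finset.mem_insert_of_mem h.zero_mem
  reach := by
    have hS : ∀ x ∈ S, Relation.ReflTransGen (fun a b => b ∈ insert v S ∧ b ≠ 0 ∧ a = f b) 0 x :=
      fun x hx => Relation.ReflTransGen.mono
        (fun a b h => ⟨Finset.mem_insert_of_mem h.1, h.2⟩) _ _ (h.reach x hx)
    intro x hx
    rcases Finset.mem_insert.1 hx with rfl | hx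
    · refine (hS _ hf).tail ⟨hx, ?_, rfl⟩
      rintro rfl
      exact hv h.zero_mem
    · exact hS x hx
  cost := by
    have hv0 : v ≠ 0 := by
      rintro rfl
      exact hv h.zero_mem
    rw [Finset.erase_insert_of_ne hv0, Finset.sum_insert (by simp [hv]), h.cost, add_comm]
  optimal := fun g hg => by
    obtain ⟨I, hI, hle⟩ := h.optimal g hg
    obtain ⟨i, hi, hcross, hconn⟩ := hI.exchange (v := v) (by simpa using hv)
    refine ⟨I.erase i, by simpa using hconn, ?_⟩
    -- The dropped edge may point out of `S` or into it; minimality covers the first case, and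
    -- symmetry of `w` reduces the second to it.
    have hi' : w (f v) v ≤ w (g i) i.succ := by
      rcases hcross with ⟨h1, h2⟩ | ⟨h1, h2⟩
      · exact hmin _ (by simpa using h1) _ (by simpa using h2)
      · rw [hw (g i)]
        exact hmin _ (by simpa using h1) _ (by simpa using h2)
    have := Finset.add_sum_erase I (fun i => w (g i) i.succ) (by simpa using hi)
    linarith

theorem IsOptimalPart.isArborescence {f : Fin (n + 1) → Fin (n + 1)} {c : ℚ}
    (h : IsOptimalPart w Finset.univ f c) : IsArborescence fun i => f i.succ := fun v => by
  refine Relation.ReflTransGen.mono ?_ _ _ (h.reach v (Finset.mem_univ v))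
  rintro a b ⟨-, hb, hab⟩
  obtain ⟨i, rfl⟩ := Fin.exists_succ_eq.2 hb
  exact ⟨i, hab, rfl⟩

theorem IsOptimalPart.cost_eq {f : Fin (n + 1) → Fin (n + 1)} {c : ℚ}
    (h : IsOptimalPart w Finset.univ f c) : c = ∑ i : Fin n, w (f i.succ) i.succ := by
  have := Finset.add_sum_erase Finset.univ (fun v => w (f v) v) (Finset.mem_univ 0)
  rw [Fin.sum_univ_succ] at this
  rw [h.cost]
  linarith

/-- The edges of `g` that remain in the comparison have nonnegative weight and can be discarded. -/
theorem IsOptimalPart.le (hw : ∀ a b, 0 ≤ w a b) {S : Finset (Fin (n + 1))}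
    {f : Fin (n + 1) → Fin (n + 1)} {c : ℚ} (h : IsOptimalPart w S f c)
    {g : Fin n → Fin (n + 1)} (hg : IsArborescence g) : c ≤ ∑ i, w (g i) i.succ := by
  obtain ⟨I, -, hle⟩ := h.optimal g hg
  have : 0 ≤ ∑ i ∈ I, w (g i) i.succ := Finset.sum_nonneg fun i _ => hw _ _
  linarith

end Growing

/-! ## Reasoning about programs -/

namespace RAM

/-- Weakest precondition: started in `s`, the program halts, and final state, time and calls
satisfy `Φ`. -/
def wp (p : Prog) (s : State) (Φ : State → ℕ → List Prog → Prop) : Prop :=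
  ∃ s' t c, Exec p s s' t c ∧ Φ s' t c

theorem wp_mono {p : Prog} {s : State} {Φ Ψ : State → ℕ → List Prog → Prop} (h : wp p s Φ)
    (hΦ : ∀ s' t c, Φ s' t c → Ψ s' t c) : wp p s Ψ := by
  obtain ⟨s', t, c, he, h⟩ := h
  exact ⟨s', t, c, he, hΦ _ _ _ h⟩

section Rules

variable {s : State} {Φ : State → ℕ → List Prog → Prop}

theorem wp_skip : wp .skip s Φ ↔ Φ s 1 [] := by
  constructor
  · rintro ⟨_, _, _, ⟨⟩, h⟩
    exact h
  · exact fun h => ⟨_, _, _, .skip s, h⟩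

theorem wp_const {r : ℕ} {q : ℚ} : wp (.const r q) s Φ ↔ Φ (s.setReg r q) 1 [] := by
  constructor
  · rintro ⟨_, _, _, ⟨⟩, h⟩
    exact h
  · exact fun h => ⟨_, _, _, .const s r q, h⟩

theorem wp_add {r a b : ℕ} :
    wp (.add r a b) s Φ ↔ Φ (s.setReg r (s.reg a + s.reg b)) 1 [] := by
  constructor
  · rintro ⟨_, _, _, ⟨⟩, h⟩
    exact h
  · exact fun h => ⟨_, _, _, .add s r a b, h⟩

theorem wp_sub {r a b : ℕ} :
    wp (.sub r a b) s Φ ↔ Φ (s.setReg r (s.reg a - s.reg b)) 1 [] := by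
  constructor
  · rintro ⟨_, _, _, ⟨⟩, h⟩
    exact h
  · exact fun h => ⟨_, _, _, .sub s r a b, h⟩

theorem wp_load {r m a : ℕ} :
    wp (.load r m a) s Φ ↔ Φ (s.setReg r (s.mem m (s.addr a))) 1 [] := by
  constructor
  · rintro ⟨_, _, _, ⟨⟩, h⟩
    exact h
  · exact fun h => ⟨_, _, _, .load s r m a, h⟩

theorem wp_store {m a r : ℕ} :
    wp (.store m a r) s Φ ↔ Φ (s.setMem m (s.addr a) (s.reg r)) 1 [] := by
  constructor
  · rintro ⟨_, _, _, ⟨⟩, h⟩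
    exact h
  · exact fun h => ⟨_, _, _, .store s m a r, h⟩

theorem wp_write {r : ℕ} :
    wp (.write r) s Φ ↔ Φ { s with out := s.out ++ [s.reg r] } 1 [] := by
  constructor
  · rintro ⟨_, _, _, ⟨⟩, h⟩
    exact h
  · exact fun h => ⟨_, _, _, .write s r, h⟩

theorem wp_seq {p q : Prog} : wp (.seq p q) s Φ ↔
    wp p s fun s₁ t₁ c₁ => wp q s₁ fun s₂ t₂ c₂ => Φ s₂ (t₁ + t₂) (c₁ ++ c₂) := by
  constructor
  · rintro ⟨_, _, _, ⟨⟩, h⟩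
    exact ⟨_, _, _, by assumption, _, _, _, by assumption, h⟩
  · rintro ⟨_, _, _, h₁, _, _, _, h₂, h⟩
    exact ⟨_, _, _, .seq h₁ h₂, h⟩

theorem wp_ite {a b : ℕ} {p q : Prog} : wp (.ite a b p q) s Φ ↔
    if s.reg a ≤ s.reg b then wp p s fun s' t c => Φ s' (1 + t) c
    else wp q s fun s' t c => Φ s' (1 + t) c := by
  constructor
  · rintro ⟨_, _, _, he, h⟩
    cases he with
    | ite_true hab he =>
      rw [if_pos hab]
      exact ⟨_, _, _, he, h⟩
    | ite_false hab he =>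
      rw [if_neg hab]
      exact ⟨_, _, _, he, h⟩
  · split_ifs with hab
    · rintro ⟨_, _, _, he, h⟩
      exact ⟨_, _, _, .ite_true hab he, h⟩
    · rintro ⟨_, _, _, he, h⟩
      exact ⟨_, _, _, .ite_false hab he, h⟩

/-- A loop that runs from `j` to `N` and keeps an invariant. -/
theorem wp_while {a b : ℕ} {p D : Prog} (Inv : ℕ → State → Prop) (N τ κ : ℕ)
    (hcond : ∀ j s, j ≤ N → Inv j s → (s.reg a < s.reg b ↔ j < N))
    (hbody : ∀ j s, j < N → Inv j s →
      wp p s fun s' t c => Inv (j + 1) s' ∧ t ≤ τ ∧ c.count D ≤ κ)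
    {j : ℕ} (hj : j ≤ N) (h : Inv j s) :
    wp (.while a b p) s fun s' t c =>
      Inv N s' ∧ t ≤ (N - j) * (τ + 1) + 1 ∧ c.count D ≤ (N - j) * κ := by
  -- Induction on the number `d` of remaining rounds. Each costs the body and one test; the final
  -- failing test is the extra 1.
  obtain ⟨d, rfl⟩ := Nat.exists_eq_add_of_le hj
  rw [Nat.add_sub_cancel_left]
  induction d generalizing j s with
  | zero =>
    refine ⟨_, _, _, .while_false ?_, h, ?_, ?_⟩
    · rw [hcond j s le_rfl h]
      exact lt_irrefl j
    · simp
    · simp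
  | succ d ih =>
    have hlt : j < j + (d + 1) := by omega
    obtain ⟨s₁, t₁, c₁, he₁, h₁, ht₁, hc₁⟩ := hbody j s hlt h
    have e : j + 1 + d = j + (d + 1) := by omega
    obtain ⟨s₂, t₂, c₂, he₂, h₂, ht₂, hc₂⟩ :=
      ih (j := j + 1) h₁ (by rwa [e]) (by rwa [e]) (by omega)
    refine ⟨_, _, _, .while_true ((hcond j s hj h).2 hlt) he₁ he₂, e ▸ h₂, ?_, ?_⟩
    · linarith
    · rw [List.count_append]
      linarith

theorem wp_call {p : Prog} {m l d r : ℕ} {w : List ℚ} (hw : s.slice m (s.addr l) = w)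
    {v : List ℚ} {t : ℕ} {c : List Prog} (h : Runs p w v t c)
    (hΦ : Φ ((s.paste d v).setReg r (v.length : ℚ)) (callCost w v t) (p :: c)) :
    wp (.call p m l d r) s Φ := by
  obtain ⟨s₁, he, rfl⟩ := h
  subst hw
  exact ⟨_, _, _, .call he, hΦ⟩

end Rules

/-- Sequential composition of a list of programs. -/
def Prog.block : List Prog → Prog
  | [] => .skip
  | p :: l => .seq p (block l)

theorem wp_block_nil {s : State} {Φ : State → ℕ → List Prog → Prop} :
    wp (.block []) s Φ ↔ Φ s 1 [] := wp_skip

theorem wp_block_cons {p : Prog} {l : List Prog} {s : State}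
    {Φ : State → ℕ → List Prog → Prop} : wp (.block (p :: l)) s Φ ↔
      wp p s fun s₁ t₁ c₁ => wp (.block l) s₁ fun s₂ t₂ c₂ => Φ s₂ (t₁ + t₂) (c₁ ++ c₂) := wp_seq

/-- An instruction writes at most one word, and the output of a subroutine goes to memory, not to
the output of its caller. -/
theorem Exec.length_out_le {p : Prog} {s s' : State} {t : ℕ} {c : List Prog}
    (h : Exec p s s' t c) : s'.out.length ≤ s.out.length + t := by
  induction h <;> (try simp [State.setReg, State.setMem, State.paste]) <;> omega

theorem Runs.length_le {p : Prog} {w v : List ℚ} {t : ℕ} {c : List Prog} (h : Runs p w v t c) :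
    v.length ≤ t := by
  obtain ⟨s, he, rfl⟩ := h
  simpa [State.init] using he.length_out_le

/-- Subroutines are part of the program text, so a called program is a proper subterm. This rules
out hidden calls of `D` inside `D` when calls are counted. -/
theorem Exec.sizeOf_lt {p : Prog} {s s' : State} {t : ℕ} {c : List Prog} (h : Exec p s s' t c) :
    ∀ q ∈ c, sizeOf q < sizeOf p := by
  induction h with
  | call _ ih =>
    intro q hq
    rcases List.mem_cons.1 hq with rfl | hq
    · simp
      omega
    · have := ih q hq
      simp
      omega
  | while_true _ _ _ ih₁ ih₂ =>
    intro q hq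
    rcases List.mem_append.1 hq with hq | hq
    · have := ih₁ q hq
      simp
      omega
    · exact ih₂ q hq
  | seq _ _ ih₁ ih₂ =>
    intro q hq
    rcases List.mem_append.1 hq with hq | hq
    · have := ih₁ q hq
      simp
      omega
    · have := ih₂ q hq
      simp
      omega
  | ite_true _ _ ih | ite_false _ _ ih =>
    intro q hq
    have := ih q hq
    simp
    omega
  | _ => simp

/-- A program does not call itself. -/
theorem Runs.count_self {p : Prog} {w v : List ℚ} {t : ℕ} {c : List Prog} (h : Runs p w v t c) :
    c.count p = 0 := by
  obtain ⟨s, he, -⟩ := h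
  exact List.count_eq_zero.2 fun hp => lt_irrefl _ (he.sizeOf_lt p hp)

/-! ### Fields of a state after an update -/

section Fields

variable (s : State)

theorem setReg_reg (r : ℕ) (q : ℚ) (r' : ℕ) :
    (s.setReg r q).reg r' = if r' = r then q else s.reg r' := rfl

theorem setReg_mem (r : ℕ) (q : ℚ) : (s.setReg r q).mem = s.mem := rfl

theorem setReg_out (r : ℕ) (q : ℚ) : (s.setReg r q).out = s.out := rfl

theorem setMem_reg (m i : ℕ) (q : ℚ) : (s.setMem m i q).reg = s.reg := rfl

theorem setMem_mem (m i : ℕ) (q : ℚ) (m' i' : ℕ) :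
    (s.setMem m i q).mem m' i' = if m' = m ∧ i' = i then q else s.mem m' i' := rfl

theorem setMem_mem_of_ne (m i : ℕ) (q : ℚ) {m' : ℕ} (h : m' ≠ m) :
    (s.setMem m i q).mem m' = s.mem m' := by
  funext i'
  simp [setMem_mem, h]

theorem setMem_out (m i : ℕ) (q : ℚ) : (s.setMem m i q).out = s.out := rfl

theorem addr_eq {s : State} {r i : ℕ} (h : s.reg r = i) : s.addr r = i := by
  simp [State.addr, h]

end Fields

/-! ### Words stored in memory -/

/-- The words `w` are found in a memory from address `a` on. -/
def Holds (μ : ℕ → ℚ) (a : ℕ) (w : List ℚ) : Prop := ∀ k (h : k < w.length), μ (a + k) = w[k]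

theorem Holds.append {μ : ℕ → ℚ} {a : ℕ} {v w : List ℚ} (hv : Holds μ a v)
    (hw : Holds μ (a + v.length) w) : Holds μ a (v ++ w) := by
  intro k hk
  by_cases h : k < v.length
  · rw [List.getElem_append_left h]
    exact hv k h
  · rw [List.getElem_append_right (by omega), ← hw (k - v.length) (by grind)]
    congr 1
    omega

theorem Holds.congr {μ ν : ℕ → ℚ} {a b : ℕ} {w : List ℚ} (h : Holds μ a w)
    (he : ∀ k < w.length, ν (b + k) = μ (a + k)) : Holds ν b w :=
  fun k hk => (he k hk).trans (h k hk)

theorem Holds.slice_eq {s : State} {m : ℕ} {w : List ℚ} (h : Holds (s.mem m) 0 w) :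
    s.slice m w.length = w := by
  refine List.ext_getElem (by simp [State.slice]) fun k _ hk => ?_
  simpa [State.slice] using h k hk

/-- For parsing: the front of the unread input is found in memory at the read position. -/
theorem Holds.of_drop {μ : ℕ → ℚ} {w v u : List ℚ} (h : Holds μ 0 w) {a : ℕ}
    (hd : w.drop a = v ++ u) : Holds μ a v := by
  intro k hk
  have hl : a + k < w.length := by
    have := congrArg List.length hd
    simp at this
    omega
  have e : (w.drop a)[k]'(by simp; omega) = v[k] := by simp [hd, hk]
  rw [← e, List.getElem_drop]
  simpa using h (a + k) hl

theorem holds_paste (s : State) (m : ℕ) (w : List ℚ) : Holds ((s.paste m w).mem m) 0 w := by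
  intro k hk
  simp [State.paste, hk]

theorem paste_mem_of_ne (s : State) {m m' : ℕ} (w : List ℚ) (h : m' ≠ m) :
    (s.paste m w).mem m' = s.mem m' := by
  funext i
  simp [State.paste, h]

end RAM

/-! ## Queries for minimum-cost edit paths -/

namespace RAM

/-- Append the encoding of the node with the index in register `r` to memory `6`; register `13` is
the write position. -/
def copyNode (r : ℕ) : Prog := .block
  -- Registers 10 and 11 become the two ends of the block. The length word is copied too, hence the
  -- extra addition of 1, held in register 2.
  [.load 10 1 r, .load 11 0 10, .add 11 11 10, .add 11 11 2,
    .while 10 11 (.block [.load 12 0 10, .store 6 13 12, .add 10 10 2, .add 13 13 2])]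

/-- Call `D` on the nodes with the indices in registers `a` and `b`. The answer is put into
memory `7`, its length into register `14`. -/
def query (D : Prog) (a b : ℕ) : Prog := .block
  [.sub 13 13 13, copyNode a, copyNode b, .call D 6 13 7 14]

/-- A query changes only the registers `10, …, 14` and the memories from `6` on. -/
structure QueryFrame (s s' : State) : Prop where
  reg : ∀ r, r < 10 ∨ 14 < r → s'.reg r = s.reg r
  mem : ∀ m < 6, s'.mem m = s.mem m
  out : s'.out = s.out

theorem QueryFrame.trans {s₁ s₂ s₃ : State} (h : QueryFrame s₁ s₂) (h' : QueryFrame s₂ s₃) :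
    QueryFrame s₁ s₃ where
  reg r hr := (h'.reg r hr).trans (h.reg r hr)
  mem m hm := (h'.mem m hm).trans (h.mem m hm)
  out := h'.out.trans h.out

theorem QueryFrame.refl (s : State) : QueryFrame s s := ⟨fun _ _ => rfl, fun _ _ => rfl, rfl⟩

theorem QueryFrame.setReg {s s' : State} (h : QueryFrame s s') {r : ℕ} (hr : 10 ≤ r)
    (hr' : r ≤ 14) (q : ℚ) : QueryFrame s (s'.setReg r q) where
  reg r' hr := by
    rw [setReg_reg, if_neg (by omega), h.reg r' hr]
  mem := h.mem
  out := h.out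

theorem QueryFrame.setMem {s s' : State} (h : QueryFrame s s') {m : ℕ} (hm : 6 ≤ m) (i : ℕ)
    (q : ℚ) : QueryFrame s (s'.setMem m i q) where
  reg := h.reg
  mem m' hm' := by
    rw [setMem_mem_of_ne _ _ _ _ (by omega), h.mem m' hm']
  out := h.out

theorem QueryFrame.paste {s s' : State} (h : QueryFrame s s') {m : ℕ} (hm : 6 ≤ m)
    (v : List ℚ) : QueryFrame s (s'.paste m v) where
  reg := h.reg
  mem m' hm' := by
    rw [paste_mem_of_ne _ _ (by omega), h.mem m' hm']
  out := h.out

/-- The clause on addresses below `b` protects the first argument of a query while the second is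
copied behind it. -/
theorem wp_copyNode (D : Prog) {s : State} {r v a b : ℕ} {l : List ℚ} (hone : s.reg 2 = 1)
    (hb : s.reg 13 = b) (hr : s.reg r = v) (ha : s.mem 1 v = a)
    (hl : Holds (s.mem 0) a (withLength l)) :
    wp (copyNode r) s fun s' t c => QueryFrame s s' ∧
      s'.reg 13 = (b + (withLength l).length : ℕ) ∧ Holds (s'.mem 6) b (withLength l) ∧
      (∀ i < b, s'.mem 6 i = s.mem 6 i) ∧ t ≤ 6 * (withLength l).length + 10 ∧
      c.count D = 0 := by
  have hlen : s.mem 0 a = l.length := by simpa [withLength] using hl 0 (by simp [withLength])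
  simp only [copyNode, wp_block_cons, wp_load, wp_add, setReg_reg, setReg_mem, reduceIte,
    hr, ha, State.addr, Nat.floor_natCast, hlen, hone, Nat.reduceEqDiff]
  let N := (withLength l).length
  have hN : N = l.length + 1 := rfl
  -- The bound 5 for the body counts four instructions and the `skip` that ends a block; the loop
  -- test makes it 6 per word.
  refine wp_mono (wp_while (D := D) (j := 0) (fun j s' => QueryFrame s s' ∧
    s'.reg 10 = (a + j : ℕ) ∧ s'.reg 11 = (a + N : ℕ) ∧ s'.reg 13 = (b + j : ℕ) ∧
    (∀ i < j, s'.mem 6 (b + i) = s.mem 0 (a + i)) ∧ ∀ i < b, s'.mem 6 i = s.mem 6 i)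
    N 5 0 ?_ ?_ (Nat.zero_le _) ?_) ?_
  · rintro j s' - ⟨-, h10, h11, -⟩
    rw [h10, h11, Nat.cast_lt]
    omega
  · rintro j s' hj ⟨hf, h10, h11, h13, hmem, hold⟩
    have hone' : s'.reg 2 = 1 := by rw [hf.reg 2 (by omega), hone]
    have h0 : s'.mem 0 = s.mem 0 := hf.mem 0 (by omega)
    simp only [wp_block_cons, wp_block_nil, wp_load, wp_add, wp_store, setReg_reg, setReg_mem,
      reduceIte, State.addr, h13, Nat.floor_natCast, hone', Nat.reduceEqDiff,
      setMem_reg, setMem_mem, true_and, h0, h10, h11]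
    refine ⟨⟨(((hf.setReg ?_ ?_ _).setMem ?_ _ _).setReg ?_ ?_ _).setReg ?_ ?_ _, ?_, ?_, ?_, ?_⟩,
      ?_, ?_⟩ <;> try omega
    · push_cast
      ring
    · push_cast
      ring
    · intro i hi
      split_ifs with h
      · congr 1
        omega
      · exact hmem i (by omega)
    · intro i hi
      rw [if_neg (by omega), hold i hi]
    · simp
  · refine ⟨((((QueryFrame.refl s).setReg ?_ ?_ _).setReg ?_ ?_ _).setReg ?_ ?_ _).setReg ?_ ?_ _,
      ?_, ?_, ?_, ?_, ?_⟩ <;> try omega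
    · simp [setReg_reg]
    · simp [setReg_reg, hN]
      ring
    · simp [setReg_reg, hb]
    · exact fun _ _ => rfl
  · rintro s' t c ⟨⟨hf, -, -, h13, hmem, hold⟩, ht, hc⟩
    simp only [wp_block_nil]
    refine ⟨hf, h13, hl.congr hmem, hold, ?_, ?_⟩
    · change t ≤ (N - 0) * 6 + 1 at ht
      change _ ≤ 6 * N + 10
      omega
    · simpa using hc

variable {n : ℕ}

/-- `D` answers queries about pairs of nodes. The first word of the answer is the weight `w u v`,
the others satisfy `R u v`, and `T` bounds the cost of the call. -/
def Oracle (D : Prog) (enc : Fin (n + 1) → List ℚ) (w : Fin (n + 1) → Fin (n + 1) → ℚ)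
    (R : Fin (n + 1) → Fin (n + 1) → List ℚ → Prop) (T : ℕ) : Prop :=
  ∀ u v, ∃ l t c, Runs D (withLength (enc u) ++ withLength (enc v)) (w u v :: l) t c ∧ R u v l ∧
    callCost (withLength (enc u) ++ withLength (enc v)) (w u v :: l) t ≤ T

/-- The constants of the program are in their registers, and the encodings of all nodes are in
memory `0`, at the addresses in memory `1`. -/
structure Ready (enc : Fin (n + 1) → List ℚ) (s : State) : Prop where
  zero : s.reg 1 = 0
  one : s.reg 2 = 1
  bound : s.reg 3 = (n + 1 : ℕ)
  size : s.reg 17 = n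
  node : ∀ v : Fin (n + 1), ∃ a : ℕ, s.mem 1 v = a ∧ Holds (s.mem 0) a (withLength (enc v))

theorem Ready.of_eq {enc : Fin (n + 1) → List ℚ} {s s' : State} (h : Ready enc s)
    (h1 : s'.reg 1 = s.reg 1) (h2 : s'.reg 2 = s.reg 2) (h3 : s'.reg 3 = s.reg 3)
    (h17 : s'.reg 17 = s.reg 17) (hm0 : s'.mem 0 = s.mem 0) (hm1 : s'.mem 1 = s.mem 1) :
    Ready enc s' where
  zero := h1.trans h.zero
  one := h2.trans h.one
  bound := h3.trans h.bound
  size := h17.trans h.size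
  node := by
    rw [hm0, hm1]
    exact h.node

variable {D : Prog} {enc : Fin (n + 1) → List ℚ} {w : Fin (n + 1) → Fin (n + 1) → ℚ}
  {R : Fin (n + 1) → Fin (n + 1) → List ℚ → Prop} {T : ℕ}

/-- Copying takes 6 steps per argument word. Since `T` also pays for passing the arguments, copying
costs at most 6`T` plus a constant, and the call itself `T`. -/
theorem wp_query (hD : Oracle D enc w R T) {s : State} (hs : Ready enc s) {a b : ℕ}
    {u v : Fin (n + 1)} (ha : s.reg a = (u : ℕ)) (hb : s.reg b = (v : ℕ)) (ha' : a < 10)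
    (hb' : b < 10) :
    wp (query D a b) s fun s' t c => QueryFrame s s' ∧ (∃ l, R u v l ∧
      Holds (s'.mem 7) 0 (w u v :: l) ∧ s'.reg 14 = (l.length + 1 : ℕ) ∧ l.length + 1 ≤ T) ∧
      t ≤ 7 * T + 25 ∧ c.count D ≤ 1 := by
  obtain ⟨l, td, cd, hrun, hR, hT⟩ := hD u v
  simp only [query, wp_block_cons, wp_sub, sub_self]
  obtain ⟨x, hx, hux⟩ := hs.node u
  obtain ⟨y, hy, hvy⟩ := hs.node v
  have hf₀ : QueryFrame s (s.setReg 13 0) := (QueryFrame.refl s).setReg (by omega) (by omega) _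
  refine wp_mono (wp_copyNode D (s := s.setReg 13 0) (r := a) (v := u) (a := x) (b := 0)
    hs.one ?_ ?_ hx hux) ?_
  · simp [setReg_reg]
  · rw [hf₀.reg _ (.inl ha'), ha]
  rintro s₁ t₁ c₁ ⟨hf₁, h13, hl₁, -, ht₁, hc₁⟩
  have hf₁ := hf₀.trans hf₁
  refine wp_mono (wp_copyNode D (r := b) (v := v) (a := y) (l := enc v) ?_ h13 ?_ ?_ ?_) ?_
  · rw [hf₁.reg _ (by omega), hs.one]
  · rw [hf₁.reg _ (.inl hb'), hb]
  · rw [hf₁.mem _ (by omega), hy]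
  · rw [hf₁.mem _ (by omega)]
    exact hvy
  rintro s₂ t₂ c₂ ⟨hf₂, h13', hl₂, hold, ht₂, hc₂⟩
  have hf₂ := hf₁.trans hf₂
  have harg : s₂.slice 6 (s₂.addr 13) = withLength (enc u) ++ withLength (enc v) := by
    have : s₂.addr 13 = (withLength (enc u) ++ withLength (enc v)).length := by
      rw [addr_eq h13', List.length_append]
      omega
    rw [this]
    refine Holds.slice_eq (Holds.append (hl₁.congr fun k hk => hold _ ?_) hl₂)
    omega
  refine wp_call harg hrun ?_
  rw [wp_block_nil]
  refine ⟨(hf₂.paste (by omega) _).setReg (by omega) (by omega) _,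
    ⟨l, hR, by
      rw [setReg_mem]
      exact holds_paste _ _ _, by simp [setReg_reg], ?_⟩, ?_, ?_⟩
  · simp only [callCost, List.length_append, List.length_cons] at hT
    omega
  · simp only [callCost, List.length_append, List.length_cons] at hT ht₁ ht₂ ⊢
    omega
  · have := hrun.count_self
    simp only [List.count_append, List.count_nil, List.count_cons_self, hc₁, hc₂, this]
    omega

end RAM

/-! ## The main loop of Prim's algorithm -/

namespace RAM

/-- Let the current node be the parent of node `v` if that is the first or a better choice. -/
def improve : Prog :=
  -- Register 4 is the round number and register 1 is zero: in round 0 there is no stored distance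
  -- to compare with.
  .ite 4 1 (.block [.store 4 6 15, .store 5 6 5])
    (.ite 16 15 .skip (.block [.store 4 6 15, .store 5 6 5]))

/-- Let node `v` be the candidate for the next node if it is the first or a better one. -/
def select : Prog :=
  -- Index 0 in register 7 stands for "no candidate yet"; the root is always in the tree and never a
  -- candidate. Adding register 1, which is zero, copies a register.
  .ite 7 1 (.block [.add 7 6 1, .add 8 16 1])
    (.ite 8 16 .skip (.block [.add 7 6 1, .add 8 16 1]))

/-- Process node `v` in a round of Prim's algorithm. -/
def relax (D : Prog) : Prog := .block
  [.load 16 3 6,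
    .ite 2 16 .skip (.block
      -- The distance is loaded again after `improve`, because `select` has to compare the updated
      -- value.
      [query D 5 6, .load 15 7 1, .load 16 4 6, improve, .load 16 4 6, select]),
    .add 6 6 2]

/-- A round of Prim's algorithm. -/
def grow (D : Prog) : Prog := .block
  -- The scan starts at node 1. The root is in the tree from the beginning and is never marked in
  -- memory 3.
  [.sub 7 7 7, .add 6 1 2, .while 6 3 (relax D), .store 3 7 2, .add 5 7 1, .add 9 9 8, .add 4 4 2]

variable {n : ℕ}

/-- Memories `δ` and `π` hold the least weight of an edge from `A` to `v`, and a node of `A` where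
it is attained. -/
def Nearest (w : Fin (n + 1) → Fin (n + 1) → ℚ) (A : Finset (Fin (n + 1))) (δ π : ℕ → ℚ)
    (v : Fin (n + 1)) : Prop :=
  ∃ a ∈ A, π v = (a : ℕ) ∧ δ v = w a v ∧ ∀ b ∈ A, w a v ≤ w b v

/-- Among the nodes below `k` and outside `S`, the one with index `q` has the least entry in the
memory `δ`, namely `d`; or `q` is zero, and there are no such nodes. -/
def IsCandidate (S : Finset (Fin (n + 1))) (δ : ℕ → ℚ) (k : ℕ) (q d : ℚ) : Prop :=
  (q = 0 ∧ ∀ v ∉ S, k ≤ (v : ℕ)) ∨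
    ∃ b ∉ S, (b : ℕ) < k ∧ q = (b : ℕ) ∧ d = δ b ∧ ∀ v ∉ S, (v : ℕ) < k → d ≤ δ v

theorem Nearest.congr {w : Fin (n + 1) → Fin (n + 1) → ℚ} {A : Finset (Fin (n + 1))}
    {δ π δ' π' : ℕ → ℚ} {v : Fin (n + 1)} (h : Nearest w A δ π v) (hδ : δ' v = δ v)
    (hπ : π' v = π v) : Nearest w A δ' π' v := by
  obtain ⟨a, ha, h1, h2, h3⟩ := h
  exact ⟨a, ha, hπ.trans h1, hδ.trans h2, h3⟩

theorem IsCandidate.congr {S : Finset (Fin (n + 1))} {δ δ' : ℕ → ℚ} {k : ℕ} {q d : ℚ}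
    (h : IsCandidate S δ k q d) (hδ : ∀ i < k, δ' i = δ i) : IsCandidate S δ' k q d := by
  rcases h with h | ⟨b, hb, hbk, hq, hd, hmin⟩
  · exact .inl h
  · refine .inr ⟨b, hb, hbk, hq, by rw [hd, hδ _ hbk], fun v hv hvk => ?_⟩
    rw [hδ _ hvk]
    exact hmin v hv hvk

theorem IsCandidate.succ_of_mem {S : Finset (Fin (n + 1))} {δ : ℕ → ℚ} {v : Fin (n + 1)} {q d : ℚ}
    (h : IsCandidate S δ v q d) (hv : v ∈ S) : IsCandidate S δ (v + 1) q d := by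
  have key : ∀ x ∉ S, (x : ℕ) ≠ v := by
    rintro x hx hxv
    rw [Fin.ext hxv] at hx
    exact hx hv
  rcases h with ⟨hq, h⟩ | ⟨b, hb, hbk, hq, hd, hmin⟩
  · refine .inl ⟨hq, fun x hx => ?_⟩
    have := key x hx
    have := h x hx
    omega
  · refine .inr ⟨b, hb, by omega, hq, hd, fun x hx hxv => hmin x hx ?_⟩
    have := key x hx
    omega

variable {w : Fin (n + 1) → Fin (n + 1) → ℚ}

/-- The stored distance refers to the tree without its newest node `u`, so only the edge from `u`
can improve it. In round 0 the tree is `{u}`, and the old contents are irrelevant. -/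
theorem wp_improve (D : Prog) {s : State} {S : Finset (Fin (n + 1))} {u v : Fin (n + 1)} {j : ℕ}
    (h1 : s.reg 1 = 0) (h4 : s.reg 4 = j) (h5 : s.reg 5 = (u : ℕ)) (h6 : s.reg 6 = (v : ℕ))
    (h15 : s.reg 15 = w u v) (h16 : s.reg 16 = s.mem 4 v) (hu : u ∈ S) (hj : j = 0 → S = {u})
    (hold : j = 0 ∨ Nearest w (S.erase u) (s.mem 4) (s.mem 5) v) :
    wp improve s fun s' t c => s'.reg = s.reg ∧ s'.out = s.out ∧
      (∀ m, m ≠ 4 → m ≠ 5 → s'.mem m = s.mem m) ∧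
      (∀ i, i ≠ (v : ℕ) → s'.mem 4 i = s.mem 4 i ∧ s'.mem 5 i = s.mem 5 i) ∧
      Nearest w S (s'.mem 4) (s'.mem 5) v ∧ t ≤ 5 ∧ c.count D = 0 := by
  simp only [improve, wp_ite, wp_block_cons, wp_block_nil, wp_store, wp_skip, h1, h4,
    h15, h16, State.addr, h6, setMem_reg, Nat.floor_natCast, h5, setMem_out]
  have hmem : ∀ m, m ≠ 4 → m ≠ 5 →
      ((s.setMem 4 v (w u v)).setMem 5 v (u : ℕ)).mem m = s.mem m := fun m h4 h5 => by
    rw [setMem_mem_of_ne _ _ _ _ h5, setMem_mem_of_ne _ _ _ _ h4]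
  have hne : ∀ i, i ≠ (v : ℕ) → ((s.setMem 4 v (w u v)).setMem 5 v (u : ℕ)).mem 4 i = s.mem 4 i ∧
      ((s.setMem 4 v (w u v)).setMem 5 v (u : ℕ)).mem 5 i = s.mem 5 i := fun i hi => by
    simp [setMem_mem, hi]
  split_ifs with hj0 hle
  · have hj0 : j = 0 := by exact_mod_cast le_antisymm hj0 (Nat.cast_nonneg j)
    refine ⟨trivial, trivial, hmem, hne, ⟨u, hu, ?_, ?_, ?_⟩, by omega, by simp⟩
    · simp [setMem_mem]
    · simp [setMem_mem]
    · simp [hj hj0]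
  · have hj0 : j ≠ 0 := by
      rintro rfl
      simp at hj0
    obtain ⟨a, ha, hπ, hδ, hmin⟩ := hold.resolve_left hj0
    refine ⟨trivial, trivial, by simp, by simp,
      ⟨a, Finset.mem_of_mem_erase ha, hπ, hδ, fun b hb => ?_⟩, by omega, by simp⟩
    by_cases hbu : b = u
    · rwa [hbu, ← hδ]
    · exact hmin b (Finset.mem_erase.2 ⟨hbu, hb⟩)
  · have hj0 : j ≠ 0 := by
      rintro rfl
      simp at hj0
    obtain ⟨a, ha, hπ, hδ, hmin⟩ := hold.resolve_left hj0
    refine ⟨trivial, trivial, hmem, hne, ⟨u, hu, ?_, ?_, fun b hb => ?_⟩, by omega, by simp⟩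
    · simp [setMem_mem]
    · simp [setMem_mem]
    · by_cases hbu : b = u
      · rw [hbu]
      · have := hmin b (Finset.mem_erase.2 ⟨hbu, hb⟩)
        linarith

theorem wp_select (D : Prog) {s : State} {S : Finset (Fin (n + 1))} {v : Fin (n + 1)}
    (h0 : 0 ∈ S) (h1 : s.reg 1 = 0) (h6 : s.reg 6 = (v : ℕ)) (h16 : s.reg 16 = s.mem 4 v)
    (hv : v ∉ S) (hc : IsCandidate S (s.mem 4) v (s.reg 7) (s.reg 8)) :
    wp select s fun s' t c => s'.mem = s.mem ∧ s'.out = s.out ∧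
      (∀ r, r ≠ 7 → r ≠ 8 → s'.reg r = s.reg r) ∧
      IsCandidate S (s.mem 4) (v + 1) (s'.reg 7) (s'.reg 8) ∧ t ≤ 5 ∧ c.count D = 0 := by
  have hreg : ∀ r, r ≠ 7 → r ≠ 8 → ((s.setReg 7 v).setReg 8 (s.mem 4 v)).reg r = s.reg r :=
    fun r h7 h8 => by rw [setReg_reg, if_neg h8, setReg_reg, if_neg h7]
  have key : ∀ x : Fin (n + 1), (x : ℕ) < v + 1 → (x : ℕ) < v ∨ x = v := fun x hx => by
    rw [Fin.ext_iff]
    omega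
  simp only [select, wp_ite, wp_block_cons, wp_block_nil, wp_add, wp_skip, h1, h16, h6, setReg_mem,
    setReg_out, add_zero, setReg_reg, Nat.reduceEqDiff, reduceIte]
  split_ifs with h7 hle
  · refine ⟨trivial, trivial, hreg, .inr ⟨v, hv, by omega, rfl, rfl, fun x hx hxv => ?_⟩, by omega,
      by simp⟩
    rcases hc with ⟨-, hc⟩ | ⟨b, hb, -, hq, -⟩
    · rcases key x hxv with h | rfl
      · have := hc x hx
        omega
      · exact le_rfl
    · rw [hq] at h7
      have : b = 0 := Fin.ext (by simpa using h7)
      exact absurd (this ▸ h0) hb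
  · rcases hc with ⟨hq, -⟩ | ⟨b, hb, hbv, hq, hd, hmin⟩
    · exact absurd hq.le h7
    · refine ⟨trivial, trivial, by simp, .inr ⟨b, hb, by omega, hq, hd, fun x hx hxv => ?_⟩,
        by omega, by simp⟩
      rcases key x hxv with h | rfl
      · exact hmin x hx h
      · exact hle
  · refine ⟨trivial, trivial, hreg, .inr ⟨v, hv, by omega, rfl, rfl, fun x hx hxv => ?_⟩, by omega,
      by simp⟩
    rcases hc with ⟨hq, -⟩ | ⟨b, hb, hbv, hq, hd, hmin⟩
    · exact absurd hq.le h7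
    · rcases key x hxv with h | rfl
      · have := hmin x hx h
        linarith
      · exact le_rfl

/-- The inner loop changes only the registers `6, 7, 8`, those for queries, and the memories for
distances, parents and queries. -/
structure RelaxFrame (s s' : State) : Prop where
  reg : ∀ r, r < 6 ∨ r = 9 ∨ r = 17 → s'.reg r = s.reg r
  mem : ∀ m < 4, s'.mem m = s.mem m
  out : s'.out = s.out

theorem Ready.relax {enc : Fin (n + 1) → List ℚ} {s s' : State} (h : Ready enc s)
    (hf : RelaxFrame s s') : Ready enc s' :=
  h.of_eq (hf.reg _ (by omega)) (hf.reg _ (by omega)) (hf.reg _ (by omega)) (hf.reg _ (by omega))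
    (hf.mem _ (by omega)) (hf.mem _ (by omega))

/-- The invariant of the inner loop when the nodes below `k` have been processed. -/
structure RelaxInv (w : Fin (n + 1) → Fin (n + 1) → ℚ) (S : Finset (Fin (n + 1)))
    (u : Fin (n + 1)) (j : ℕ) (s : State) (k : ℕ) (s' : State) : Prop where
  frame : RelaxFrame s s'
  index : s'.reg 6 = k
  parent : ∀ v ∈ S, s'.mem 5 (v : ℕ) = s.mem 5 v
  done : ∀ v ∉ S, (v : ℕ) < k → Nearest w S (s'.mem 4) (s'.mem 5) v
  todo : ∀ v ∉ S, k ≤ (v : ℕ) → j = 0 ∨ Nearest w (S.erase u) (s'.mem 4) (s'.mem 5) v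
  candidate : IsCandidate S (s'.mem 4) k (s'.reg 7) (s'.reg 8)

variable {D : Prog} {enc : Fin (n + 1) → List ℚ}
  {R : Fin (n + 1) → Fin (n + 1) → List ℚ → Prop} {T : ℕ}

theorem wp_relax (hD : Oracle D enc w R T) {s : State} (hs : Ready enc s)
    {S : Finset (Fin (n + 1))} {u : Fin (n + 1)} {j : ℕ} (h4 : s.reg 4 = j)
    (h5 : s.reg 5 = (u : ℕ)) (h0 : 0 ∈ S) (hu : u ∈ S) (hj : j = 0 → S = {u})
    (hmark : ∀ v : Fin (n + 1), v ≠ 0 → s.mem 3 v = if v ∈ S then 1 else 0)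
    {k : ℕ} (hk0 : 1 ≤ k) (hk : k < n + 1) {s₁ : State} (h : RelaxInv w S u j s k s₁) :
    wp (relax D) s₁ fun s' t c =>
      RelaxInv w S u j s (k + 1) s' ∧ t ≤ 7 * T + 50 ∧ c.count D ≤ 1 := by
  obtain ⟨hf, h6, hpar, hdone, htodo, hcand⟩ := h
  have hs₁ := hs.relax hf
  obtain ⟨v, rfl⟩ : ∃ v : Fin (n + 1), (v : ℕ) = k := ⟨⟨k, hk⟩, rfl⟩
  have hv0 : v ≠ 0 := by
    rintro rfl
    simp at hk0
  have hm : s₁.mem 3 v = if v ∈ S then 1 else 0 := by rw [hf.mem _ (by omega), hmark v hv0]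
  simp only [relax, wp_block_cons, wp_load, wp_ite, setReg_reg, Nat.reduceEqDiff, reduceIte, h6,
    State.addr, Nat.floor_natCast, hm, hs₁.one]
  have key : ∀ x : Fin (n + 1), (x : ℕ) < v + 1 → (x : ℕ) < v ∨ x = v := fun x hx => by
    rw [Fin.ext_iff]
    omega
  by_cases hv : v ∈ S
  · simp only [hv, reduceIte, le_refl, wp_skip, wp_add, wp_block_nil]
    refine ⟨⟨⟨fun r hr => ?_, hf.mem, hf.out⟩, ?_, hpar, fun x hx hxv => ?_, fun x hx hxv => ?_, ?_⟩,
      ?_, ?_⟩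
    · simp only [setReg_reg]
      rw [if_neg (by omega), if_neg (by omega), hf.reg r hr]
    · simp [setReg_reg, h6, hs₁.one]
    · rcases key x hxv with h | rfl
      · exact hdone x hx h
      · exact absurd hv hx
    · exact htodo x hx (by omega)
    · simpa [setReg_reg, setReg_mem] using hcand.succ_of_mem hv
    · omega
    · simp
  · simp only [hv, if_false, show ¬ (1 : ℚ) ≤ 0 by norm_num]
    have hs₂ : Ready enc (s₁.setReg 16 0) := hs₁.of_eq rfl rfl rfl rfl rfl rfl
    refine wp_mono (wp_query hD hs₂ (a := 5) (b := 6) (u := u) (v := v) ?_ ?_ ?_ ?_) ?_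
    · simp [setReg_reg, hf.reg, h5]
    · simp [setReg_reg, h6]
    · omega
    · omega
    rintro s₂ t₂ c₂ ⟨hq, ⟨l, -, hl, -, -⟩, ht₂, hc₂⟩
    have hw : s₂.mem 7 0 = w u v := hl 0 (by simp)
    have hr₂ : ∀ r < 10, s₂.reg r = s₁.reg r := fun r hr => by
      rw [hq.reg r (.inl hr), setReg_reg, if_neg (by omega)]
    have hm₂ : ∀ m < 6, s₂.mem m = s₁.mem m := hq.mem
    simp only [hr₂ 1 (by omega), hr₂ 6 (by omega), hs₁.zero, Nat.floor_zero, hw, h6, Nat.floor_natCast, setReg_mem]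
    refine wp_mono (wp_improve D (w := w) (S := S) (u := u) (v := v) (j := j) ?_ ?_ ?_ ?_ ?_ ?_ hu
      hj ?_) ?_
    · simp [setReg_reg, hr₂, hs₁.zero]
    · simp [setReg_reg, hr₂, hf.reg, h4]
    · simp [setReg_reg, hr₂, hf.reg, h5]
    · simp [setReg_reg, hr₂, h6]
    · simp [setReg_reg]
    · simp [setReg_reg, setReg_mem]
    · simpa [setReg_mem, hm₂] using htodo v hv le_rfl
    rintro s₃ t₃ c₃ ⟨hr₃, ho₃, hm₃, hne₃, hnear, ht₃, hc₃⟩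
    have hr₃' : ∀ r < 10, s₃.reg r = s₁.reg r := fun r hr => by
      rw [hr₃, setReg_reg, if_neg (by omega), setReg_reg, if_neg (by omega), hr₂ r hr]
    have hne₃' : ∀ i, i ≠ (v : ℕ) → s₃.mem 4 i = s₁.mem 4 i ∧ s₃.mem 5 i = s₁.mem 5 i :=
      fun i hi => by simpa [setReg_mem, hm₂] using hne₃ i hi
    simp only [hr₃' 6 (by omega), h6, Nat.floor_natCast]
    refine wp_mono (wp_select D (S := S) (v := v) h0 ?_ ?_ ?_ hv ?_) ?_
    · simp [setReg_reg, hr₃', hs₁.zero]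
    · simp [setReg_reg, hr₃', h6]
    · simp [setReg_reg, setReg_mem]
    · simp only [setReg_reg, setReg_mem, Nat.reduceEqDiff, reduceIte, hr₃' 7 (by omega),
        hr₃' 8 (by omega)]
      exact hcand.congr fun i hi => (hne₃' i hi.ne).1
    rintro s₄ t₄ c₄ ⟨hm₄, ho₄, hr₄, hc₄, ht₄, hcc₄⟩
    simp only [setReg_mem] at hm₄ hc₄
    simp only [wp_block_nil, wp_add]
    have hr₄' : ∀ r < 10, r ≠ 7 → r ≠ 8 → s₄.reg r = s₁.reg r := fun r hr h7 h8 => by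
      rw [hr₄ r h7 h8, setReg_reg, if_neg (by omega), hr₃' r hr]
    refine ⟨⟨⟨fun r hr => ?_, fun m hm => ?_, ?_⟩, ?_, fun x hx => ?_, fun x hx hxv => ?_,
      fun x hx hxv => ?_, ?_⟩, ?_, ?_⟩
    · rw [setReg_reg, if_neg (by omega), ← hf.reg r hr]
      -- Register 17 is outside the range of `hr₄'` and is traced back through all stages
      -- separately.
      by_cases h17 : r = 17
      · subst h17
        rw [hr₄ 17 (by omega) (by omega), setReg_reg, if_neg (by omega), hr₃, setReg_reg,
          if_neg (by omega), setReg_reg, if_neg (by omega), hq.reg 17 (by omega), setReg_reg,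
          if_neg (by omega)]
      · exact hr₄' r (by omega) (by omega) (by omega)
    · rw [setReg_mem, hm₄, hm₃ m (by omega) (by omega), setReg_mem, setReg_mem, hm₂ m (by omega),
        hf.mem m hm]
    · rw [setReg_out, ho₄, setReg_out, ho₃, setReg_out, setReg_out, hq.out, setReg_out, hf.out]
    · simp [setReg_reg, hr₄', h6, hs₁.one]
    · have : (x : ℕ) ≠ v := by
        rintro hxv
        rw [Fin.ext hxv] at hx
        exact hv hx
      rw [setReg_mem, hm₄, (hne₃' _ this).2, hpar x hx]
    · rw [setReg_mem, hm₄]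
      rcases key x hxv with h | rfl
      · exact (hdone x hx h).congr (hne₃' _ h.ne).1 (hne₃' _ h.ne).2
      · exact hnear
    · rw [setReg_mem, hm₄]
      refine (htodo x hx (by omega)).imp_right fun h => ?_
      exact h.congr (hne₃' _ (by omega)).1 (hne₃' _ (by omega)).2
    · simpa [setReg_reg, setReg_mem, hm₄] using hc₄
    · omega
    · simp only [List.count_append, List.count_nil, hc₃, hcc₄]
      omega

/-- The invariant of Prim's algorithm after `j` rounds, started in `s`. -/
structure GrowInv (enc : Fin (n + 1) → List ℚ) (w : Fin (n + 1) → Fin (n + 1) → ℚ) (s : State)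
    (j : ℕ) (s' : State) (S : Finset (Fin (n + 1))) (u : Fin (n + 1))
    (f : Fin (n + 1) → Fin (n + 1)) : Prop where
  ready : Ready enc s'
  input : s'.mem 0 = s.mem 0
  out : s'.out = s.out
  round : s'.reg 4 = j
  card : S.card = j + 1
  current : s'.reg 5 = (u : ℕ)
  current_mem : u ∈ S
  first : j = 0 → S = {u}
  mark : ∀ v : Fin (n + 1), v ≠ 0 → s'.mem 3 v = if v ∈ S then 1 else 0
  nearest : ∀ v ∉ S, j = 0 ∨ Nearest w (S.erase u) (s'.mem 4) (s'.mem 5) v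
  parent : ∀ v ∈ S, v ≠ 0 → s'.mem 5 (v : ℕ) = (f v : ℕ)
  optimal : IsOptimalPart w S f (s'.reg 9)

/-- In `GrowInv` the stored distances lag one node behind the tree. A single scan brings them up to
date with `u` and at the same time finds the nearest outside node. -/
theorem wp_grow (hw : ∀ a b, w a b = w b a) (hD : Oracle D enc w R T) {s s₁ : State} {j : ℕ}
    (hjn : j < n) {S : Finset (Fin (n + 1))} {u : Fin (n + 1)} {f : Fin (n + 1) → Fin (n + 1)}
    (h : GrowInv enc w s j s₁ S u f) :
    wp (grow D) s₁ fun s' t c => (∃ S u f, GrowInv enc w s (j + 1) s' S u f) ∧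
      t ≤ n * (7 * T + 51) + 12 ∧ c.count D ≤ n := by
  have h0 := h.optimal.zero_mem
  have hrdy := h.ready
  simp only [grow, wp_block_cons, wp_sub, wp_add, setReg_reg, Nat.reduceEqDiff, reduceIte,
    hrdy.zero, hrdy.one, sub_self, zero_add]
  set s₂ := (s₁.setReg 7 0).setReg 6 1 with hs₂
  have hr₂ : Ready enc s₂ := hrdy.of_eq rfl rfl rfl rfl rfl rfl
  refine wp_mono (wp_while (D := D) (fun k s' => 1 ≤ k ∧ RelaxInv w S u j s₂ k s') (j := 1)
    (n + 1) (7 * T + 50) 1 ?_ ?_ (by omega) ⟨le_rfl, ?_⟩) ?_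
  · rintro k s' - ⟨-, hk⟩
    rw [hk.index, (hr₂.relax hk.frame).bound, Nat.cast_lt]
  · rintro k s' hk ⟨hk1, hinv⟩
    refine wp_mono (wp_relax hD hr₂ ?_ ?_ h0 h.current_mem h.first ?_ hk1 hk hinv)
      fun s'' t c ⟨h1, h2, h3⟩ => ⟨⟨by omega, h1⟩, h2, h3⟩
    · simp [hs₂, setReg_reg, h.round]
    · simp [hs₂, setReg_reg, h.current]
    · exact h.mark
  · refine ⟨⟨fun r hr => ?_, fun _ _ => rfl, rfl⟩, ?_, fun _ _ => rfl, fun v hv hv1 => ?_,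
      fun v hv _ => h.nearest v hv, .inl ⟨?_, fun v hv => ?_⟩⟩
    · rfl
    · simp [hs₂, setReg_reg]
    · have : v = 0 := Fin.ext (by simpa using hv1)
      exact absurd (this ▸ h0) hv
    · simp [hs₂, setReg_reg]
    · by_contra hv1
      have : v = 0 := Fin.ext (by simpa using hv1)
      exact absurd (this ▸ h0) hv
  · rintro s₃ t c ⟨⟨-, hinv⟩, ht, hc⟩
    have hr₃ := hr₂.relax hinv.frame
    -- The tree has `j + 1` nodes, fewer than `n + 1`, so the scan does find a candidate.
    obtain ⟨x, hx⟩ : ∃ x, x ∉ S := by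
      by_contra! hall
      have := Finset.card_eq_iff_eq_univ S |>.2 (Finset.eq_univ_iff_forall.2 hall)
      rw [h.card, Fintype.card_fin] at this
      omega
    obtain ⟨b, hb, -, h7, h8, hmin⟩ := hinv.candidate.resolve_left fun hc => by
      have := hc.2 x hx
      have := x.2
      omega
    obtain ⟨a, ha, hπ, hδ, ha'⟩ := hinv.done b hb b.2
    have hb0 : b ≠ 0 := by
      rintro rfl
      exact hb h0
    have h9 : s₃.reg 9 = s₁.reg 9 := hinv.frame.reg 9 (by omega)
    have h4 : s₃.reg 4 = s₁.reg 4 := hinv.frame.reg 4 (by omega)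
    simp only [wp_store, wp_block_nil, setMem_reg, hr₃.one, hr₃.zero, State.addr, h7,
      Nat.floor_natCast, add_zero, h9, h4, h.round]
    refine ⟨⟨insert b S, b, Function.update f b a, ⟨hr₃.of_eq rfl rfl rfl rfl ?_ ?_, ?_, ?_, ?_, ?_,
      ?_, by simp, by simp, fun v hv => ?_, fun v hv => .inr ?_, fun v hv hv0 => ?_, ?_⟩⟩, ?_, ?_⟩
    · simp [setReg_mem, setMem_mem_of_ne]
    · simp [setReg_mem, setMem_mem_of_ne]
    · simp only [setReg_mem]
      rw [setMem_mem_of_ne _ _ _ _ (by omega), hinv.frame.mem 0 (by omega)]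
      exact h.input
    · simp only [setReg_out, setMem_out]
      rw [hinv.frame.out]
      exact h.out
    · simp [setReg_reg]
    · rw [Finset.card_insert_of_notMem hb, h.card]
    · simp [setReg_reg]
    · have : s₃.mem 3 = s₁.mem 3 := hinv.frame.mem 3 (by omega)
      simp only [setReg_mem, setMem_mem, this, h.mark v hv, Finset.mem_insert, ← Fin.ext_iff]
      by_cases hvb : v = b <;> simp [hvb]
    · rw [Finset.erase_insert hb]
      have hv' : v ∉ S := fun hvS => hv (Finset.mem_insert_of_mem hvS)
      refine (hinv.done v hv' v.2).congr ?_ ?_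
      · simp [setReg_mem, setMem_mem]
      · simp [setReg_mem, setMem_mem]
    · simp only [setReg_mem]
      rw [setMem_mem_of_ne _ _ _ _ (by omega)]
      by_cases hvb : v = b
      · rw [hvb, Function.update_self, hπ]
      · have hvS := (Finset.mem_insert.1 hv).resolve_left hvb
        rw [Function.update_of_ne hvb, hinv.parent v hvS]
        exact h.parent v hvS hv0
    · have hopt : IsOptimalPart w S (Function.update f b a) (s₁.reg 9) :=
        h.optimal.congr fun v hv _ => by
          rw [Function.update_of_ne]
          rintro rfl
          exact hb hv
      -- The distance of `b` is least among outside nodes, and each such distance is a minimum over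
      -- `S`; so the new edge is lightest in the whole cut.
      have := hopt.extend hw hb (by simpa using ha) (fun x hx y hy => by
        rw [Function.update_self, ← hδ, ← h8]
        obtain ⟨z, -, -, hz, hz'⟩ := hinv.done y hy y.2
        exact (hmin y hy y.2).trans (hz ▸ hz' x hx))
      rw [Function.update_self, ← hδ, ← h8] at this
      simpa [setReg_reg] using this
    · change t ≤ n * (7 * T + 51) + 1 at ht
      omega
    · simp only [List.count_append, List.count_nil]
      omega

/-- Prim's algorithm. -/
def prim (D : Prog) : Prog := .while 4 17 (grow D)

theorem wp_prim (hw : ∀ a b, w a b = w b a) (hD : Oracle D enc w R T) {s : State}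
    (hs : Ready enc s) (h4 : s.reg 4 = 0) (h5 : s.reg 5 = 0) (h9 : s.reg 9 = 0)
    (hmark : ∀ v, s.mem 3 v = 0) :
    wp (prim D) s fun s' t c => Ready enc s' ∧ s'.mem 0 = s.mem 0 ∧ s'.out = s.out ∧
      (∃ f : Fin (n + 1) → Fin (n + 1), (∀ v : Fin (n + 1), v ≠ 0 → s'.mem 5 v = (f v : ℕ)) ∧
        IsOptimalPart w Finset.univ f (s'.reg 9)) ∧
      t ≤ n * (n * (7 * T + 51) + 13) + 1 ∧ c.count D ≤ n * n := by
  -- The tree starts as the root alone, so any parent function would serve in place of `id`.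
  refine wp_mono (wp_while (D := D) (fun j s' => ∃ S u f, GrowInv enc w s j s' S u f) (j := 0) n
    (n * (7 * T + 51) + 12) n ?_ ?_ (Nat.zero_le _)
    ⟨{0}, 0, id, hs, rfl, rfl, ?_, ?_, ?_, ?_, ?_, ?_, ?_, ?_, ?_⟩) ?_
  · rintro j s' - ⟨S, u, f, h⟩
    rw [h.round, h.ready.size, Nat.cast_lt]
  · rintro j s' hj ⟨S, u, f, h⟩
    exact wp_grow hw hD hj h
  · simpa using h4
  · simp
  · simpa using h5
  · simp
  · simp
  · intro v hv
    simp [hv, hmark]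
  · simp
  · intro v hv hv0
    simp [hv0] at hv
  · rw [h9]
    exact isOptimalPart_singleton _
  · rintro s' t c ⟨⟨S, u, f, h⟩, ht, hc⟩
    have hS : S = Finset.univ := Finset.card_eq_iff_eq_univ S |>.1 (by simp [h.card])
    subst hS
    exact ⟨h.ready, h.input, h.out, ⟨f, fun v hv => h.parent v (Finset.mem_univ v) hv, h.optimal⟩,
      ht, hc⟩

end RAM

/-! ## Setting up the memory, and writing the result -/

namespace RAM

/-- Write the words `l` to memory `0`, from the address in register `10` on. -/
def storeWords : List ℚ → Prog
  | [] => .skip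
  | q :: l => .block [.const 12 q, .store 0 10 12, .add 10 10 2, storeWords l]

/-- Initialize the registers and the addresses of the nodes. The number of nodes without the root is
at address `off` of the input and is followed by their encodings; `l` is the encoding of the
root. -/
def setup (off : ℕ) (l : List ℚ) : Prog := .block
  -- Register 0 holds the input length. The root is stored directly behind the input, so this length
  -- is also its address, entered at index 0 of memory 1.
  [.const 2 1, .add 10 0 1, storeWords (withLength l), .store 1 1 0, .const 10 off, .load 17 0 10,
    .add 3 17 2, .const 6 1, .add 10 10 2,
    .while 6 3 (.block
      [.store 1 6 10, .load 11 0 10, .add 10 10 11, .add 10 10 2, .add 6 6 2])]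

/-- Write the parents of all nodes, each with the answer to the query about parent and node. -/
def writeTree (D : Prog) : Prog := .block
  [.write 17, .const 6 1,
    .while 6 3 (.block
      -- Reading starts at word 1 of the answer: word 0 is the cost, which the encoding of an
      -- arborescence does not contain.
      [.load 5 5 6, .write 5, query D 5 6, .const 16 1,
        .while 16 14 (.block [.load 15 7 16, .write 15, .add 16 16 2]), .add 6 6 2])]

/-- Compare the total weight with the first word of the input. -/
def decideTotal : Prog := .block [.load 10 0 1, .ite 9 10 (.write 2) (.write 1)]

theorem wp_storeWords (D : Prog) (l : List ℚ) {s : State} {a : ℕ} (h2 : s.reg 2 = 1)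
    (h10 : s.reg 10 = a) :
    wp (storeWords l) s fun s' t c => (∀ r, r ≠ 10 → r ≠ 12 → s'.reg r = s.reg r) ∧
      (∀ m, m ≠ 0 → s'.mem m = s.mem m) ∧ s'.out = s.out ∧ Holds (s'.mem 0) a l ∧
      (∀ i < a, s'.mem 0 i = s.mem 0 i) ∧ t ≤ 4 * l.length + 1 ∧ c.count D = 0 := by
  induction l generalizing s a with
  | nil => simp [storeWords, wp_skip, Holds]
  | cons q l ih =>
    simp only [storeWords, wp_block_cons, wp_const, wp_store, wp_add, setMem_reg, setReg_reg,
      Nat.reduceEqDiff, reduceIte, State.addr, h10, Nat.floor_natCast, h2]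
    refine wp_mono (ih (s := (((s.setReg 12 q).setMem 0 a q).setReg 10 (a + 1))) (a := a + 1)
      ?_ ?_) ?_
    · simp [setReg_reg, setMem_reg, h2]
    · simp [setReg_reg]
    · rintro s' t c ⟨hr, hm, ho, hl, hold, ht, hc⟩
      rw [wp_block_nil]
      refine ⟨fun r h10 h12 => ?_, fun m hm0 => ?_, ho, fun k hk => ?_, fun i hi => ?_, ?_, ?_⟩
      · rw [hr r h10 h12, setReg_reg, if_neg h10, setMem_reg, setReg_reg, if_neg h12]
      · rw [hm m hm0, setReg_mem, setMem_mem_of_ne _ _ _ _ hm0, setReg_mem]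
      · cases k with
        | zero => simp [hold a (by omega), setReg_mem, setMem_mem]
        | succ k =>
          have := hl k (by simpa using hk)
          rw [add_right_comm] at this
          exact this
      · rw [hold i (by omega), setReg_mem, setMem_mem, if_neg (by omega), setReg_mem]
      · rw [List.length_cons]
        omega
      · simp [hc]

variable {n : ℕ} {enc : Fin (n + 1) → List ℚ}

theorem drop_ofFn {α : Type*} (g : Fin n → α) {j : ℕ} (hj : j < n) :
    (List.ofFn g).drop j = g ⟨j, hj⟩ :: (List.ofFn g).drop (j + 1) := by
  rw [List.drop_eq_getElem_cons (by simpa using hj)]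
  simp

/-- The prefix `pre` is empty for the optimization problem and consists of the threshold for the
decision problem. -/
theorem wp_setup (D : Prog) {pre w : List ℚ}
    (hw : w = pre ++ (n : ℚ) :: (List.ofFn fun i : Fin n => withLength (enc i.succ)).flatten) :
    wp (setup pre.length (enc 0)) (.init w) fun s t c => Ready enc s ∧ s.reg 4 = 0 ∧
      s.reg 5 = 0 ∧ s.reg 9 = 0 ∧ (∀ v, s.mem 3 v = 0) ∧ s.out = [] ∧ Holds (s.mem 0) 0 w ∧
      t ≤ 7 * n + 4 * (enc 0).length + 25 ∧ c.count D = 0 := by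
  simp only [setup, wp_block_cons, wp_const, wp_add]
  refine wp_mono (wp_storeWords D _ (a := w.length) ?_ ?_) ?_
  · simp [setReg_reg]
  · simp [setReg_reg, State.init]
  rintro s₁ t₁ c₁ ⟨hr, hm, ho, hl, hold, ht₁, hc₁⟩
  have hr0 : s₁.reg 0 = w.length := by simp [hr, setReg_reg, State.init]
  have hr1 : s₁.reg 1 = 0 := by simp [hr, setReg_reg, State.init]
  have hr2 : s₁.reg 2 = 1 := by simp [hr, setReg_reg]
  have hin : Holds (s₁.mem 0) 0 w := fun k hk => by
    rw [zero_add, hold k hk]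
    simp [setReg_mem, State.init, hk]
  have hn : s₁.mem 0 pre.length = n := by
    have := hin pre.length (by simp [hw])
    simpa [hw] using this
  simp only [wp_store, wp_load, setMem_reg, setReg_reg, setReg_mem, Nat.reduceEqDiff, reduceIte,
    State.addr, Nat.floor_natCast, hr1, hr2, hr0, Nat.floor_zero,
    setMem_mem_of_ne s₁ 1 0 _ (show (0 : ℕ) ≠ 1 by omega), hn]
  -- Parsing invariant: from the read position on, the input is the concatenation of the encodings
  -- not yet visited.
  refine wp_mono (wp_while (D := D) (fun j s => s.reg 1 = 0 ∧ s.reg 2 = 1 ∧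
    s.reg 3 = (n + 1 : ℕ) ∧ s.reg 17 = n ∧ s.reg 4 = 0 ∧ s.reg 5 = 0 ∧ s.reg 9 = 0 ∧
    (∀ v, s.mem 3 v = 0) ∧ s.out = [] ∧ s.mem 0 = s₁.mem 0 ∧ s.reg 6 = (j + 1 : ℕ) ∧
    (∃ a : ℕ, s.reg 10 = a ∧ w.drop a =
      ((List.ofFn fun i : Fin n => withLength (enc i.succ)).drop j).flatten) ∧
    ∀ v : Fin (n + 1), (v : ℕ) < j + 1 →
      ∃ a : ℕ, s.mem 1 v = a ∧ Holds (s.mem 0) a (withLength (enc v)))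
    (j := 0) n 6 0 ?_ ?_ (Nat.zero_le n) ⟨?_, ?_, ?_, ?_, ?_, ?_, ?_, ?_, ?_, ?_, ?_, ?_, ?_⟩) ?_
  · rintro j s - ⟨-, -, h3, -, -, -, -, -, -, -, h6, -, -⟩
    rw [h3, h6, Nat.cast_lt]
    omega
  · rintro j s hj ⟨h1, h2, h3, h17, h4, h5, h9, hm3, ho, hm0, h6, ⟨a, h10, ha⟩, hv⟩
    rw [drop_ofFn _ hj, List.flatten_cons] at ha
    have hblk : Holds (s.mem 0) a (withLength (enc (Fin.succ ⟨j, hj⟩))) := by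
      rw [hm0]
      exact hin.of_drop ha
    have hlen : s.mem 0 a = (enc (Fin.succ ⟨j, hj⟩)).length := by
      simpa [withLength] using hblk 0 (by simp [withLength])
    simp only [wp_block_cons, wp_block_nil, wp_load, wp_add, wp_store, setReg_reg, setReg_mem,
      reduceIte, State.addr, h10, h6, Nat.floor_natCast, h2, Nat.reduceEqDiff, setMem_reg,
      setMem_mem_of_ne s 1 _ _ (show (0 : ℕ) ≠ 1 by omega), hlen, setMem_out, setReg_out,
      setMem_mem_of_ne s 1 _ _ (show (3 : ℕ) ≠ 1 by omega)]
    refine ⟨⟨h1, trivial, h3, h17, h4, h5, h9, hm3, ho, hm0, by push_cast; rfl,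
      ⟨a + (withLength (enc (Fin.succ ⟨j, hj⟩))).length, ?_, ?_⟩, fun v hvj => ?_⟩, by omega,
      by simp⟩
    · simp [withLength, add_assoc]
    · rw [← List.drop_drop, ha, List.drop_left]
    · rw [setMem_mem]
      by_cases hvj' : (v : ℕ) = j + 1
      · refine ⟨a, by simp [hvj'], ?_⟩
        have : v = Fin.succ ⟨j, hj⟩ := Fin.ext hvj'
        rwa [this]
      · rw [if_neg (by omega)]
        exact hv v (by omega)
  · simp [setReg_reg, setMem_reg, hr1]
  · simp [setReg_reg, setMem_reg, hr2]
  · simp [setReg_reg]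
  · simp [setReg_reg]
  · simp [setReg_reg, setMem_reg, hr, State.init]
  · simp [setReg_reg, setMem_reg, hr, State.init]
  · simp [setReg_reg, setMem_reg, hr, State.init]
  · simp [setReg_mem, setMem_mem, hm, State.init]
  · simp [setReg_out, setMem_out, ho, State.init]
  · simp [setReg_mem, setMem_mem_of_ne]
  · simp [setReg_reg]
  · refine ⟨pre.length + 1, by simp [setReg_reg], ?_⟩
    rw [hw, ← List.drop_drop, List.drop_left]
    simp
  · intro v hv
    have : v = 0 := Fin.ext (by simpa using hv)
    subst this
    exact ⟨w.length, by simp [setReg_mem, setMem_mem],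
      by simpa [setReg_mem, setMem_mem_of_ne] using hl⟩
  · rintro s t c ⟨⟨h1, h2, h3, h17, h4, h5, h9, hm3, ho, hm0, h6, -, hv⟩, ht, hc⟩
    rw [wp_block_nil]
    refine ⟨⟨h1, h2, h3, h17, fun v => hv v v.2⟩, h4, h5, h9, hm3, ho, by rwa [hm0], ?_, ?_⟩
    · simp only [withLength, List.length_cons] at ht₁
      omega
    · simpa [hc₁] using hc

variable {D : Prog} {w : Fin (n + 1) → Fin (n + 1) → ℚ}
  {R : Fin (n + 1) → Fin (n + 1) → List ℚ → Prop} {T : ℕ}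

theorem wp_writeAnswer (D : Prog) {s : State} {q : ℚ} {l : List ℚ} (hl : Holds (s.mem 7) 0 (q :: l))
    (h2 : s.reg 2 = 1) (h14 : s.reg 14 = (l.length + 1 : ℕ)) (h16 : s.reg 16 = 1) :
    wp (.while 16 14 (.block [.load 15 7 16, .write 15, .add 16 16 2])) s fun s' t c =>
      (∀ r, r ≠ 15 → r ≠ 16 → s'.reg r = s.reg r) ∧ s'.mem = s.mem ∧ s'.out = s.out ++ l ∧
      t ≤ 5 * l.length + 1 ∧ c.count D = 0 := by
  refine wp_mono (wp_while (D := D) (j := 0) (fun j s' =>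
    (∀ r, r ≠ 15 → r ≠ 16 → s'.reg r = s.reg r) ∧ s'.mem = s.mem ∧
    s'.out = s.out ++ l.take j ∧ s'.reg 16 = (j + 1 : ℕ)) l.length 4 0 ?_ ?_ (Nat.zero_le _)
    ⟨fun _ _ _ => rfl, rfl, by simp, by simpa using h16⟩) ?_
  · rintro j s' - ⟨hr, -, -, h16⟩
    rw [h16, hr 14 (by omega) (by omega), h14, Nat.cast_lt]
    omega
  · rintro j s' hj ⟨hr, hm, ho, h16⟩
    have hlj : s.mem 7 (j + 1) = l[j] := by
      have := hl (j + 1) (by simpa using hj)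
      rw [zero_add] at this
      exact this
    simp only [wp_block_cons, wp_block_nil, wp_load, wp_write, wp_add, setReg_reg, setReg_mem,
      setReg_out, reduceIte, Nat.reduceEqDiff, State.addr, h16, Nat.floor_natCast, hm, hlj,
      hr 2 (by omega) (by omega), h2, ho]
    refine ⟨⟨fun r h15 h16 => ?_, trivial, ?_, ?_⟩, by omega, by simp⟩
    · rw [if_neg h16, if_neg h15, hr r h15 h16]
    · rw [List.take_succ_eq_append_getElem hj, List.append_assoc]
    · push_cast
      rfl
  · rintro s' t c ⟨⟨hr, hm, ho, -⟩, ht, hc⟩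
    refine ⟨hr, hm, by rw [ho, List.take_length], ?_, by simpa using hc⟩
    omega

/-- A query takes at most 7`T` + 25 steps. Its answer has at most `T` words, each written in 5
steps, which gives the 12`T`. -/
theorem wp_writeTree (hD : Oracle D enc w R T) {s : State} (hs : Ready enc s) (ho : s.out = [])
    {f : Fin (n + 1) → Fin (n + 1)} (hf : ∀ v : Fin (n + 1), v ≠ 0 → s.mem 5 v = (f v : ℕ)) :
    wp (writeTree D) s fun s' t c => (∃ g : Fin n → List ℚ,
      (∀ i, R (f i.succ) i.succ (g i)) ∧
      s'.out = (n : ℚ) :: (List.ofFn fun i => ((f i.succ : ℕ) : ℚ) :: g i).flatten) ∧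
      t ≤ n * (12 * T + 50) + 5 ∧ c.count D ≤ n := by
  simp only [writeTree, wp_block_cons, wp_block_nil, wp_const, wp_write]
  refine wp_mono (wp_while (D := D) (fun j s' => Ready enc s' ∧ s'.mem 5 = s.mem 5 ∧
    s'.reg 6 = (j + 1 : ℕ) ∧ ∃ bs : List (List ℚ), bs.length = j ∧
      (∀ (i : Fin n) (hi : (i : ℕ) < bs.length), ∃ l, R (f i.succ) i.succ l ∧
        bs[(i : ℕ)] = ((f i.succ : ℕ) : ℚ) :: l) ∧ s'.out = (n : ℚ) :: bs.flatten)
    (j := 0) n (12 * T + 49) 1 ?_ ?_ (Nat.zero_le n)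
    ⟨hs.of_eq rfl rfl rfl rfl rfl rfl, rfl, by simp [setReg_reg], [], rfl, by simp, ?_⟩) ?_
  · rintro j s' - ⟨hr, -, h6, -⟩
    rw [hr.bound, h6, Nat.cast_lt]
    omega
  · rintro j s' hj ⟨hr, hm5, h6, bs, hbs, hR, hout⟩
    have hfj := hf (Fin.succ ⟨j, hj⟩) (Fin.succ_ne_zero _)
    rw [Fin.val_succ] at hfj
    simp only [wp_block_cons, wp_block_nil, wp_load, wp_write, wp_const, wp_add, setReg_reg,
      reduceIte, State.addr, h6, Nat.floor_natCast, hm5, hfj, setReg_out, hout]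
    have hr₀ : Ready enc { s'.setReg 5 (f (Fin.succ ⟨j, hj⟩) : ℕ) with
        out := (n : ℚ) :: bs.flatten ++ [((f (Fin.succ ⟨j, hj⟩) : ℕ) : ℚ)] } :=
      hr.of_eq rfl rfl rfl rfl rfl rfl
    refine wp_mono (wp_query hD hr₀ (a := 5) (b := 6) (u := f (Fin.succ ⟨j, hj⟩)) (v := Fin.succ ⟨j, hj⟩)
      ?_ ?_ (by omega) (by omega)) ?_
    · simp [setReg_reg]
    · simp [setReg_reg, h6]
    rintro s₁ t₁ c₁ ⟨hq, ⟨l, hRl, hl, h14, hlT⟩, ht₁, hc₁⟩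
    have hr₁ : Ready enc s₁ := hr₀.of_eq (hq.reg _ (by omega)) (hq.reg _ (by omega))
      (hq.reg _ (by omega)) (hq.reg _ (by omega)) (hq.mem _ (by omega)) (hq.mem _ (by omega))
    have h6₁ : s₁.reg 6 = (j + 1 : ℕ) := by
      rw [hq.reg 6 (by omega)]
      simp [setReg_reg, h6]
    have ho₁ := hq.out
    have hm₁ : s₁.mem 5 = s.mem 5 := (hq.mem 5 (by omega)).trans hm5
    refine wp_mono (wp_writeAnswer D (s := s₁.setReg 16 1) hl ?_ ?_ ?_) ?_
    · simp [setReg_reg, hr₁.one]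
    · simp only [setReg_reg, Nat.reduceEqDiff, reduceIte, h14]
    · simp [setReg_reg]
    rintro s₂ t₂ c₂ ⟨hr₂, hm₂, ho₂, ht₂, hc₂⟩
    have hr₂' : ∀ r, r ≠ 15 → r ≠ 16 → s₂.reg r = s₁.reg r := fun r h15 h16 => by
      rw [hr₂ r h15 h16, setReg_reg, if_neg h16]
    rw [setReg_mem] at hm₂
    refine ⟨⟨hr₁.of_eq (hr₂' 1 (by omega) (by omega)) ?_ (hr₂' 3 (by omega) (by omega))
      (hr₂' 17 (by omega) (by omega)) ?_ ?_, ?_, ?_,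
      bs ++ [((f (Fin.succ ⟨j, hj⟩) : ℕ) : ℚ) :: l], ?_, fun i hi => ?_, ?_⟩, ?_, ?_⟩
    · simp [setReg_reg, hr₂', hr₁.one]
    · rw [setReg_mem, hm₂]
    · rw [setReg_mem, hm₂]
    · rw [setReg_mem, hm₂, hm₁]
    · simp [hr₂', hr₁.one, h6₁]
    · simp [hbs]
    · by_cases hij : (i : ℕ) < bs.length
      · rw [List.getElem_append_left hij]
        exact hR i hij
      · have : i = ⟨j, hj⟩ := Fin.ext (by
          simp at hi
          simp
          omega)
        subst this
        refine ⟨l, hRl, ?_⟩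
        simp [hbs]
    · rw [ho₂, setReg_out, ho₁]
      simp
    · omega
    · simp only [List.count_append, List.count_nil, hc₂]
      omega
  · simp [setReg_out, ho, hs.size]
  · rintro s' t c ⟨⟨-, -, -, bs, hbs, hR, hout⟩, ht, hc⟩
    choose! g hg using fun i : Fin n => hR i (hbs ▸ i.2)
    refine ⟨⟨g, fun i => (hg i).1, ?_⟩, ?_, ?_⟩
    · rw [hout]
      congr 2
      refine List.ext_getElem (by simp [hbs]) fun i hi _ => ?_
      rw [List.getElem_ofFn]
      exact (hg ⟨i, hbs ▸ hi⟩).2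
    · change t ≤ n * (12 * T + 50) + 1 at ht
      omega
    · simp only [List.count_append, List.count_nil]
      omega

theorem wp_decideTotal {s : State} (hs : Ready enc s) (ho : s.out = []) :
    wp decideTotal s fun s' t _ =>
      s'.out = (if s.reg 9 ≤ s.mem 0 0 then [1] else [0]) ∧ t ≤ 5 := by
  simp only [decideTotal, wp_block_cons, wp_block_nil, wp_load, wp_ite, wp_write, setReg_reg,
    reduceIte, Nat.reduceEqDiff, State.addr, hs.zero, hs.one, Nat.floor_zero, setReg_out, ho]
  split_ifs <;> simp

end RAM

/-! ## The minimum edit arborescence problem -/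

namespace RAM

variable {n : ℕ} {D : Prog} {enc : Fin (n + 1) → List ℚ} {w : Fin (n + 1) → Fin (n + 1) → ℚ}
  {R : Fin (n + 1) → Fin (n + 1) → List ℚ → Prop} {T : ℕ}

/-- Compute a minimum arborescence; `l` is the encoding of the root. -/
def arborescenceProg (D : Prog) (l : List ℚ) : Prog := .block [setup 0 l, prim D, writeTree D]

/-- Decide whether the weight of a minimum arborescence is at most the first word of the input. -/
def thresholdProg (D : Prog) (l : List ℚ) : Prog := .block [setup 1 l, prim D, decideTotal]

theorem wp_arborescenceProg (hw : ∀ a b, w a b = w b a) (hD : Oracle D enc w R T) :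
    wp (arborescenceProg D (enc 0))
      (.init ((n : ℚ) :: (List.ofFn fun i : Fin n => withLength (enc i.succ)).flatten))
      fun s t c => (∃ (f : Fin (n + 1) → Fin (n + 1)) (q : ℚ) (g : Fin n → List ℚ),
        IsOptimalPart w Finset.univ f q ∧ (∀ i, R (f i.succ) i.succ (g i)) ∧
        s.out = (n : ℚ) :: (List.ofFn fun i => ((f i.succ : ℕ) : ℚ) :: g i).flatten) ∧
        t ≤ n * (n * (7 * T + 51)) + n * (12 * T + 70) + 4 * (enc 0).length + 32 ∧
        c.count D ≤ n * n + n := by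
  simp only [arborescenceProg, wp_block_cons, wp_block_nil]
  refine wp_mono (wp_setup D (pre := []) rfl) ?_
  rintro s₁ t₁ c₁ ⟨hs₁, h4, h5, h9, h3, ho₁, -, ht₁, hc₁⟩
  refine wp_mono (wp_prim hw hD hs₁ h4 h5 h9 h3) ?_
  rintro s₂ t₂ c₂ ⟨hs₂, -, ho₂, ⟨f, hf, hopt⟩, ht₂, hc₂⟩
  refine wp_mono (wp_writeTree hD hs₂ (ho₂.trans ho₁) hf) ?_
  rintro s₃ t₃ c₃ ⟨⟨g, hg, ho₃⟩, ht₃, hc₃⟩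
  refine ⟨⟨f, _, g, hopt, hg, ho₃⟩, ?_, ?_⟩
  · linarith
  · simp only [List.count_append, List.count_nil]
    omega

theorem wp_thresholdProg (hw : ∀ a b, w a b = w b a) (hD : Oracle D enc w R T) (k : ℚ) :
    wp (thresholdProg D (enc 0))
      (.init (k :: (n : ℚ) :: (List.ofFn fun i : Fin n => withLength (enc i.succ)).flatten))
      fun s t _ => (∃ (f : Fin (n + 1) → Fin (n + 1)) (q : ℚ), IsOptimalPart w Finset.univ f q ∧
        s.out = if q ≤ k then [1] else [0]) ∧
        t ≤ n * (n * (7 * T + 51)) + n * (12 * T + 70) + 4 * (enc 0).length + 32 := by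
  simp only [thresholdProg, wp_block_cons, wp_block_nil]
  refine wp_mono (wp_setup D (pre := [k]) rfl) ?_
  rintro s₁ t₁ c₁ ⟨hs₁, h4, h5, h9, h3, ho₁, hin, ht₁, -⟩
  refine wp_mono (wp_prim hw hD hs₁ h4 h5 h9 h3) ?_
  rintro s₂ t₂ c₂ ⟨hs₂, h0, ho₂, ⟨f, hf, hopt⟩, ht₂, -⟩
  refine wp_mono (wp_decideTotal hs₂ (ho₂.trans ho₁)) ?_
  rintro s₃ t₃ c₃ ⟨ho₃, ht₃⟩
  have hk : s₂.mem 0 0 = k := by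
    rw [h0]
    simpa using hin 0 (by simp)
  rw [hk] at ho₃
  exact ⟨⟨f, _, hopt, ho₃⟩, by nlinarith [Nat.zero_le (n * T)]⟩

/-- The term n`T` is absorbed by n²`T` because n ≤ n², and all terms free of `T` by (n + 1)². `K` is
the length of the encoding of the root. -/
theorem steps_le (n T K : ℕ) : n * (n * (7 * T + 51)) + n * (12 * T + 70) + 4 * K + 32 ≤
    (4 * K + 200) * (n ^ 2 * T + (n + 1) ^ 2) := by
  have h1 := Nat.le_self_pow two_ne_zero n
  have h2 := Nat.mul_le_mul_right T h1
  nlinarith [Nat.zero_le (K * (n ^ 2 * T)), Nat.zero_le (K * n ^ 2), Nat.zero_le (K * n),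
    Nat.zero_le (n ^ 2 * T)]

end RAM

/-! ### From minimum arborescences to edit arborescences -/

namespace EditSystem

variable {Ω : Type*} {Op : Type*} {E : EditSystem Ω Op}

theorem IsMinEditPath.pathCost_eq {x y : Ω} {P Q : List Op} (hP : E.IsMinEditPath x y P)
    (hQ : E.IsMinEditPath x y Q) : E.pathCost P = E.pathCost Q :=
  le_antisymm (hP.2 Q hQ.1) (hQ.2 P hP.1)

theorem IsMinEditPath.editDist_eq {x y : Ω} {P : List Op} (hP : E.IsMinEditPath x y P) :
    E.editDist x y = ((E.pathCost P : ℚ≥0) : ℝ) := by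
  refine IsLeast.csInf_eq ⟨⟨⟨P, hP.1⟩, rfl⟩, ?_⟩
  rintro _ ⟨Q, rfl⟩
  have := hP.2 Q.1 Q.2
  dsimp only
  exact_mod_cast this

/-- The cost of a minimum-cost edit path, as a word. -/
noncomputable def minCost (hE : E.IsEditSpace) (x y : Ω) : ℚ :=
  (E.pathCost (hE.exists_min x y).choose : ℚ≥0)

theorem IsMinEditPath.cost_eq_minCost (hE : E.IsEditSpace) {x y : Ω} {P : List Op}
    (hP : E.IsMinEditPath x y P) : ((E.pathCost P : ℚ≥0) : ℚ) = minCost hE x y := by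
  rw [minCost, hP.pathCost_eq (hE.exists_min x y).choose_spec]

/-- Symmetry is assumed for the real-valued distance; it passes to the rational costs because the
infimum is attained. -/
theorem minCost_comm (hE : E.IsEditSpace) (x y : Ω) : minCost hE x y = minCost hE y x := by
  have h := hE.dist_comm x y
  rw [(hE.exists_min x y).choose_spec.editDist_eq, (hE.exists_min y x).choose_spec.editDist_eq] at h
  unfold minCost
  exact_mod_cast h

theorem minCost_nonneg (hE : E.IsEditSpace) (x y : Ω) : 0 ≤ minCost hE x y := by
  unfold minCost
  positivity

theorem minCost_le (hE : E.IsEditSpace) {x y : Ω} {P : List Op} (hP : P ∈ E.editPaths x y) :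
    minCost hE x y ≤ (E.pathCost P : ℚ≥0) := by
  unfold minCost
  exact_mod_cast (hE.exists_min x y).choose_spec.2 P hP

variable (eΩ : WordEncoding Ω) (eOp : WordEncoding Op)

theorem node_mem (xs : List Ω) (v : Fin (xs.length + 1)) : E.node xs v ∈ E.null :: xs := by
  refine Fin.cases ?_ (fun i => ?_) v
  · simp [node]
  · simp [node]

theorem encList_eq (E : EditSystem Ω Op) (xs : List Ω) : eΩ.encList xs = (xs.length : ℚ) ::
    (List.ofFn fun i : Fin xs.length => withLength (eΩ.enc (E.node xs i.succ))).flatten := by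
  rw [WordEncoding.encList, List.flatMap]
  congr 2
  refine List.ext_getElem (by simp) fun i _ _ => ?_
  simp [node]

/-- Every call of `D` on two of the objects `x₀, …, xₙ` gives a correct answer at a cost of at
most `T`. -/
def AnswersWithin (E : EditSystem Ω Op) (D : RAM.Prog) (xs : List Ω) (T : ℕ) : Prop :=
  ∀ x ∈ E.null :: xs, ∀ y ∈ E.null :: xs, ∃ v t c, RAM.Runs D (eΩ.encPair (x, y)) v t c ∧
    (E.minEditPathProblem eΩ eOp).Correct (x, y) v ∧ RAM.callCost (eΩ.encPair (x, y)) v t ≤ T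

variable {eΩ eOp}

theorem AnswersWithin.oracle (hE : E.IsEditSpace) {D : RAM.Prog} {xs : List Ω} {T : ℕ}
    (h : AnswersWithin eΩ eOp E D xs T) :
    RAM.Oracle D (fun v => eΩ.enc (E.node xs v))
      (fun u v => minCost hE (E.node xs u) (E.node xs v))
      (fun u v l => ∃ P, E.IsMinEditPath (E.node xs u) (E.node xs v) P ∧ l = eOp.encList P) T := by
  intro u v
  obtain ⟨_, t, c, hrun, ⟨P, hP, rfl⟩, hT⟩ := h _ (node_mem xs u) _ (node_mem xs v)
  -- `D` may return a different path from the one chosen in `minCost`; their costs agree.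
  rw [hP.cost_eq_minCost hE] at hrun hT
  exact ⟨_, t, c, hrun, ⟨P, hP, rfl⟩, hT⟩

/-- The total weight of any arborescence of minimum weight is a lower bound for the cost of an edit
arborescence. -/
theorem le_cost (hE : E.IsEditSpace) {xs : List Ω} {f : Fin (xs.length + 1) → Fin (xs.length + 1)}
    {q : ℚ} (h : IsOptimalPart (fun u v => minCost hE (E.node xs u) (E.node xs v)) Finset.univ f q)
    (A : E.EditArborescence xs) : q ≤ (A.cost : ℚ≥0) := by
  refine (h.le (fun _ _ => minCost_nonneg hE _ _) A.reachable).trans ?_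
  rw [EditArborescence.cost]
  push_cast
  exact Finset.sum_le_sum fun i _ => minCost_le hE (A.path_mem i)

/-- An arborescence of minimum weight becomes an edit arborescence by minimum-cost edit paths. -/
def ofOptimalPart (hE : E.IsEditSpace) {xs : List Ω}
    {f : Fin (xs.length + 1) → Fin (xs.length + 1)} {q : ℚ}
    (h : IsOptimalPart (fun u v => minCost hE (E.node xs u) (E.node xs v)) Finset.univ f q)
    (P : Fin xs.length → List Op)
    (hP : ∀ i, E.IsMinEditPath (E.node xs (f i.succ)) (E.node xs i.succ) (P i)) :
    E.EditArborescence xs where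
  parent i := f i.succ
  reachable := h.isArborescence
  path := P
  path_mem i := (hP i).1

theorem cost_ofOptimalPart (hE : E.IsEditSpace) {xs : List Ω}
    {f : Fin (xs.length + 1) → Fin (xs.length + 1)} {q : ℚ}
    (h : IsOptimalPart (fun u v => minCost hE (E.node xs u) (E.node xs v)) Finset.univ f q)
    (P : Fin xs.length → List Op)
    (hP : ∀ i, E.IsMinEditPath (E.node xs (f i.succ)) (E.node xs i.succ) (P i)) :
    (((ofOptimalPart hE h P hP).cost : ℚ≥0) : ℚ) = q := by
  refine Eq.trans ?_ h.cost_eq.symm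
  rw [EditArborescence.cost]
  push_cast
  exact Finset.sum_congr rfl fun i _ => (hP i).cost_eq_minCost hE

theorem AnswersWithin.runs_arborescenceProg (hE : E.IsEditSpace) {D : RAM.Prog} {xs : List Ω}
    {T : ℕ} (h : AnswersWithin eΩ eOp E D xs T) :
    ∃ v t c, RAM.Runs (RAM.arborescenceProg D (eΩ.enc E.null)) (eΩ.encList xs) v t c ∧
      (∃ A : E.EditArborescence xs, A.IsMinimum ∧ v = A.encode eOp) ∧
      c.count D ≤ 2 * xs.length ^ 2 ∧
      t ≤ (4 * (eΩ.enc E.null).length + 200) * (xs.length ^ 2 * T + (xs.length + 1) ^ 2) := by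
  obtain ⟨s, t, c, he, ⟨f, q, g, hopt, hg, hout⟩, ht, hc⟩ :=
    RAM.wp_arborescenceProg (fun u v => minCost_comm hE _ _) (h.oracle hE)
  rw [← encList_eq] at he
  choose P hP hgP using hg
  refine ⟨_, t, c, ⟨s, he, rfl⟩, ⟨ofOptimalPart hE hopt P hP, fun A => ?_, ?_⟩, ?_, ?_⟩
  · rw [← NNRat.coe_le_coe, cost_ofOptimalPart]
    exact le_cost hE hopt A
  · rw [hout]
    simp only [hgP]
    rfl
  -- The n² queries of the search and the n queries of the output make at most 2n².
  · have := Nat.le_self_pow two_ne_zero xs.length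
    nlinarith
  · exact ht.trans (RAM.steps_le _ _ _)

theorem AnswersWithin.runs_thresholdProg (hE : E.IsEditSpace) {D : RAM.Prog} {xs : List Ω}
    {T : ℕ} (h : AnswersWithin eΩ eOp E D xs T) (k : ℚ≥0) :
    ∃ v t c, RAM.Runs (RAM.thresholdProg D (eΩ.enc E.null)) (eΩ.encMEADecision (k, xs)) v t c ∧
      (decisionProblem eΩ.encMEADecision E.MEADecision).Correct (k, xs) v ∧
      t ≤ (4 * (eΩ.enc E.null).length + 200) * (xs.length ^ 2 * T + (xs.length + 1) ^ 2) := by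
  obtain ⟨s, t, c, he, ⟨f, q, hopt, hout⟩, ht⟩ :=
    RAM.wp_thresholdProg (fun u v => minCost_comm hE _ _) (h.oracle hE) k
  rw [← encList_eq] at he
  refine ⟨_, t, c, ⟨s, he, rfl⟩, ?_, ?_⟩
  · have : q ≤ k ↔ E.MEADecision (k, xs) := by
      constructor
      · intro hq
        choose P hP using fun i : Fin xs.length =>
          hE.exists_min (E.node xs (f i.succ)) (E.node xs i.succ)
        refine ⟨ofOptimalPart hE hopt P hP, ?_⟩
        rwa [← NNRat.coe_le_coe, cost_ofOptimalPart]
      · rintro ⟨A, hA⟩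
        exact (le_cost hE hopt A).trans (NNRat.coe_le_coe.2 hA)
    simp only [decisionProblem, hout]
    congr
    exact propext this
  · exact ht.trans (RAM.steps_le _ _ _)

end EditSystem

/-! ## Polynomial bounds -/

theorem bitSize_append (v w : List ℚ) : bitSize (v ++ w) = bitSize v + bitSize w := by
  simp [bitSize]

theorem bitSize_le_of_sublist {v w : List ℚ} (h : v.Sublist w) : bitSize v ≤ bitSize w :=
  (h.map _).sum_le_sum fun _ _ => Nat.zero_le _

theorem length_le_bitSize (w : List ℚ) : w.length ≤ bitSize w := by
  induction w with
  | nil => simp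
  | cons q w ih =>
    simp only [bitSize, List.map_cons, List.sum_cons, List.length_cons] at ih ⊢
    omega

/-- The coefficients are natural numbers, so no term can decrease. -/
theorem Polynomial.eval_mono_nat (f : Polynomial ℕ) {a b : ℕ} (h : a ≤ b) :
    f.eval a ≤ f.eval b := by
  rw [Polynomial.eval_eq_sum_range, Polynomial.eval_eq_sum_range]
  gcongr

/-- Each argument is either the fixed object `z` or a block of words occurring in the input. -/
theorem WordEncoding.bitSize_encPair_le {Ω : Type*} (e : WordEncoding Ω) {z x y : Ω} {xs : List Ω}
    (hx : x ∈ z :: xs) (hy : y ∈ z :: xs) : bitSize (e.encPair (x, y)) ≤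
      2 * (bitSize (e.encList xs) + bitSize (withLength (e.enc z))) := by
  have key : ∀ x ∈ z :: xs, bitSize (withLength (e.enc x)) ≤
      bitSize (e.encList xs) + bitSize (withLength (e.enc z)) := by
    intro x hx
    rcases List.mem_cons.1 hx with rfl | hx
    · omega
    · refine (bitSize_le_of_sublist ?_).trans (Nat.le_add_right _ _)
      have : withLength (e.enc x) ∈ xs.map fun a => withLength (e.enc a) :=
        List.mem_map.2 ⟨x, hx, rfl⟩
      exact (List.sublist_flatten_of_mem this).trans (List.sublist_cons_self _ _)
  rw [encPair, bitSize_append]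
  have := key x hx
  have := key y hy
  dsimp only
  omega

/-- Even an object with empty encoding contributes its length word. -/
theorem WordEncoding.length_le_bitSize_encList {Ω : Type*} (e : WordEncoding Ω) (xs : List Ω) :
    xs.length ≤ bitSize (e.encList xs) := by
  refine le_trans ?_ (length_le_bitSize _)
  rw [encList, List.length_cons, List.length_flatMap]
  have : ∀ l : List Ω, l.length ≤ (l.map fun a => (withLength (e.enc a)).length).sum := by
    intro l
    induction l with
    | nil => simp
    | cons a l ih =>
      simp only [List.map_cons, List.sum_cons, List.length_cons, withLength] at ih ⊢
      omega
  exact (this xs).trans (Nat.le_succ _)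

namespace EditSystem

variable {Ω : Type*} {Op : Type*} {E : EditSystem Ω Op} {eΩ : WordEncoding Ω}
  {eOp : WordEncoding Op}

theorem answersWithin_of_forall_runs {D : RAM.Prog}
    (hD : (E.minEditPathProblem eΩ eOp).SolvedBy D) {xs : List Ω} {T : ℕ}
    (hT : ∀ x ∈ E.null :: xs, ∀ y ∈ E.null :: xs, ∀ v t c,
      RAM.Runs D (eΩ.encPair (x, y)) v t c → RAM.callCost (eΩ.encPair (x, y)) v t ≤ T) :
    AnswersWithin eΩ eOp E D xs T := by
  intro x hx y hy
  obtain ⟨v, t, c, hrun, hv⟩ := hD (x, y)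
  exact ⟨v, t, c, hrun, hv, hT x hx y hy v t c hrun⟩

/-- A call passes at most as many words as the argument has bits and returns at most as many as the
subroutine has steps, hence the factor 2 before `f`. The slack in `B` leaves room for the threshold
of the decision version. -/
theorem answersWithin_of_polynomial {D : RAM.Prog} {f : Polynomial ℕ}
    (hD : ∀ a : Ω × Ω, ∃ v t c, RAM.Runs D (eΩ.encPair a) v t c ∧
      (E.minEditPathProblem eΩ eOp).Correct a v ∧ t ≤ f.eval (bitSize (eΩ.encPair a)))
    {xs : List Ω} {B : ℕ} (hB : bitSize (eΩ.encList xs) ≤ B) :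
    AnswersWithin eΩ eOp E D xs (1 + 2 * (B + bitSize (withLength (eΩ.enc E.null))) +
      2 * f.eval (2 * (B + bitSize (withLength (eΩ.enc E.null))))) := by
  intro x hx y hy
  obtain ⟨v, t, c, hrun, hv, ht⟩ := hD (x, y)
  refine ⟨v, t, c, hrun, hv, ?_⟩
  have h1 := eΩ.bitSize_encPair_le hx hy
  have h2 : bitSize (eΩ.encPair (x, y)) ≤ 2 * (B + bitSize (withLength (eΩ.enc E.null))) := by
    omega
  have h3 := f.eval_mono_nat h2
  have h4 := length_le_bitSize (eΩ.encPair (x, y))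
  have h5 := hrun.length_le
  unfold RAM.callCost
  omega

/-- A polynomial that bounds the running time for the minimum edit arborescence problem. -/
noncomputable def timePolynomial (f : Polynomial ℕ) (K L : ℕ) : Polynomial ℕ :=
  Polynomial.C (4 * L + 200) * (.X ^ 2 * (1 + 2 * (.X + .C K) + 2 * f.comp (2 * (.X + .C K))) +
    (.X + 1) ^ 2)

theorem le_eval_timePolynomial (f : Polynomial ℕ) (K L : ℕ) {n B : ℕ} (h : n ≤ B) :
    (4 * L + 200) * (n ^ 2 * (1 + 2 * (B + K) + 2 * f.eval (2 * (B + K))) + (n + 1) ^ 2) ≤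
      (timePolynomial f K L).eval B := by
  simp only [timePolynomial, Polynomial.eval_mul, Polynomial.eval_add, Polynomial.eval_pow,
    Polynomial.eval_comp, Polynomial.eval_C, Polynomial.eval_X, Polynomial.eval_one,
    Polynomial.eval_ofNat]
  gcongr

theorem polyTime_mea (hE : E.IsEditSpace) (h : (E.minEditPathProblem eΩ eOp).PolyTime) :
    (E.meaProblem eΩ eOp).PolyTime := by
  obtain ⟨D, f, hD⟩ := h
  refine ⟨RAM.arborescenceProg D (eΩ.enc E.null), timePolynomial f
    (bitSize (withLength (eΩ.enc E.null))) (eΩ.enc E.null).length, fun (xs : List Ω) => ?_⟩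
  obtain ⟨v, t, c, hrun, hv, -, ht⟩ :=
    (answersWithin_of_polynomial hD (xs := xs) le_rfl).runs_arborescenceProg hE
  exact ⟨v, t, c, hrun, hv,
    ht.trans (le_eval_timePolynomial _ _ _ (eΩ.length_le_bitSize_encList xs))⟩

theorem inP_meaDecision (hE : E.IsEditSpace) (h : (E.minEditPathProblem eΩ eOp).PolyTime) :
    InP eΩ.encMEADecision E.MEADecision := by
  obtain ⟨D, f, hD⟩ := h
  refine ⟨RAM.thresholdProg D (eΩ.enc E.null), timePolynomial f
    (bitSize (withLength (eΩ.enc E.null))) (eΩ.enc E.null).length, fun (a : ℚ≥0 × List Ω) => ?_⟩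
  obtain ⟨k, xs⟩ := a
  have hB : bitSize (eΩ.encList xs) ≤ bitSize (eΩ.encMEADecision (k, xs)) :=
    bitSize_le_of_sublist (List.sublist_cons_self _ _)
  obtain ⟨v, t, c, hrun, hv, ht⟩ :=
    (answersWithin_of_polynomial hD hB).runs_thresholdProg hE k
  exact ⟨v, t, c, hrun, hv,
    ht.trans (le_eval_timePolynomial _ _ _ ((eΩ.length_le_bitSize_encList xs).trans hB))⟩

end EditSystem

theorem lemma1 {Ω : Type*} {Op : Type*} (E : EditSystem Ω Op) (hE : E.IsEditSpace)
    (eΩ : WordEncoding Ω) (eOp : WordEncoding Op) :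
    -- polynomial time
    ((E.minEditPathProblem eΩ eOp).PolyTime →
      (E.meaProblem eΩ eOp).PolyTime ∧ InP (eΩ.encMEADecision) E.MEADecision) ∧
    -- running time relative to any program `D` that computes minimum-cost edit paths; `T` bounds
    -- the cost of a call of `D` on objects of the instance
    (∀ D : RAM.Prog, (E.minEditPathProblem eΩ eOp).SolvedBy D →
      ∃ (M : RAM.Prog) (C : ℕ), ∀ (xs : List Ω) (T : ℕ),
        (∀ x ∈ E.null :: xs, ∀ y ∈ E.null :: xs, ∀ v t c,
          RAM.Runs D (eΩ.encPair (x, y)) v t c →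
            RAM.callCost (eΩ.encPair (x, y)) v t ≤ T) →
        ∃ v t c, RAM.Runs M (eΩ.encList xs) v t c ∧
          (∃ A : E.EditArborescence xs, A.IsMinimum ∧ v = A.encode eOp) ∧
          c.count D ≤ C * xs.length ^ 2 ∧
          t ≤ C * (xs.length ^ 2 * T + (xs.length + 1) ^ 2)) := by
  -- One constant serves both bounds: the number of calls needs only a factor of 2.
  refine ⟨fun h => ⟨EditSystem.polyTime_mea hE h, EditSystem.inP_meaDecision hE h⟩,
    fun D hD => ⟨RAM.arborescenceProg D (eΩ.enc E.null), 4 * (eΩ.enc E.null).length + 200,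
      fun xs T hT => ?_⟩⟩
  obtain ⟨v, t, c, hrun, hA, hc, ht⟩ :=
    (EditSystem.answersWithin_of_forall_runs hD hT).runs_arborescenceProg hE
  exact ⟨v, t, c, hrun, hA, hc.trans (Nat.mul_le_mul_right _ (by omega)), ht⟩
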